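/- For $N\in\mathbb{N}$ define the B-splines by $B_1=\chi_{[-1/2,1/2]}$, $B_{N+1}=B_N*B_1$, and for $a,b>0$ let $E_{mb}T_{na}B_N(x)=e^{2\pi i mbx}B_N(x-na)$, $m,n\in\mathbb{Z}$. Let $$\mathcal F(B_N)=\{(a,b)\in\mathbb{R}_+^2 : \{E_{mb}T_{na}B_N\}_{m,n\in\mathbb{Z}}\text{ is a frame for }L^2(\mathbb{R})\},\qquad \mathbb{R}_+=(0,\infty).$$ Let $N\ge 2$. (1) If $\{E_{mb}T_{na}B_N\}_{m,n\in\mathbb{Z}}$ is a frame for $L^2(\mathbb{R})$ for all $(a,b)\in\mathbb{R}_+^2$ with $$a<N/2,\qquad \tfrac12\le ab<1,\qquad b\notin\{2,3,\dots\},$$ then Gröchenig's conjecture holds for $B_N$, i.e. $$\mathcal F(B_N)=\{(a,b)\in\mathbb{R}_+^2 : a<N,\ ab<1,\ b\ne 2,3,\dots\}.$$ (2) The same holds for each modulation parameter separately: fix $b>0$, and suppose that, for this $b$, $\{E_{mb}T_{na}B_N\}_{m,n\in\mathbb{Z}}$ is a frame for $L^2(\mathbb{R})$ for all $a>0$ satisfying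 the three conditions in (1). Then for every $a\in\mathbb{R}$, $(a,b)\in\mathcal F(B_N)$ if and only if $a>0$, $a<N$, $ab<1$ and $b\ne 2,3,\dots$. -/

import Mathlib

open MeasureTheory
open scoped InnerProductSpace

/-- A countable family `e` in a complex Hilbert space is a frame if there are `A, B > 0` with
`A ‖f‖² ≤ ∑ i, |⟪f, e i⟫|² ≤ B ‖f‖²` for every `f` (in particular the series converges). -/
def IsHilbertFrame {ι H : Type*} [NormedAddCommGroup H] [InnerProductSpace ℂ H]
    (e : ι → H) : Prop :=
  ∃ A B : ℝ, 0 < A ∧ 0 < B ∧ ∀ f : H,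
    Summable (fun i => ‖⟪f, e i⟫_ℂ‖ ^ 2) ∧
      A * ‖f‖ ^ 2 ≤ ∑' i, ‖⟪f, e i⟫_ℂ‖ ^ 2 ∧
      ∑' i, ‖⟪f, e i⟫_ℂ‖ ^ 2 ≤ B * ‖f‖ ^ 2

/-- The modulated translate `E_{mb} T_{na} g`, that is `x ↦ e^{2π i m b x} g (x - n a)`. -/
noncomputable def gaborAtom (g : ℝ → ℂ) (a b : ℝ) (m n : ℤ) (x : ℝ) : ℂ :=
  Complex.exp (2 * (Real.pi : ℂ) * Complex.I * ((m * b * x : ℝ) : ℂ)) * g (x - n * a)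

theorem memLp_gaborAtom {g : ℝ → ℂ} (hg : MemLp g 2 volume) (a b : ℝ) (m n : ℤ) :
    MemLp (gaborAtom g a b m n) 2 volume := by
  have h1 : MemLp (fun x : ℝ => g (x - n * a)) 2 volume :=
    hg.comp_measurePreserving (measurePreserving_sub_right volume (n * a))
  refine h1.mono ?_ (Filter.Eventually.of_forall fun x => ?_)
  · have hc : Continuous fun x : ℝ =>
        Complex.exp (2 * (Real.pi : ℂ) * Complex.I * ((m * b * x : ℝ) : ℂ)) := by fun_prop
    exact hc.aestronglyMeasurable.mul h1.aestronglyMeasurable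
  · have he : 2 * (Real.pi : ℂ) * Complex.I * ((m * b * x : ℝ) : ℂ)
        = ((2 * Real.pi * (m * b * x) : ℝ) : ℂ) * Complex.I := by push_cast; ring
    rw [gaborAtom, norm_mul, he, Complex.norm_exp_ofReal_mul_I, one_mul]

/-- The Gabor system `{E_{mb} T_{na} g}`, indexed by `(m, n) ∈ ℤ × ℤ`, as a family in `L²(ℝ)`. -/
noncomputable def gaborSystem (g : ℝ → ℂ) (hg : MemLp g 2 volume) (a b : ℝ) :
    ℤ × ℤ → Lp ℂ 2 (volume : Measure ℝ) :=
  fun p => (memLp_gaborAtom hg a b p.1 p.2).toLp (gaborAtom g a b p.1 p.2)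

/-- The Gabor frame set of `g`: all `(a, b)` with `a, b > 0` for which the Gabor system is a
frame of `L²(ℝ)`. -/
def gaborFrameSet (g : ℝ → ℂ) (hg : MemLp g 2 volume) : Set (ℝ × ℝ) :=
  {p | 0 < p.1 ∧ 0 < p.2 ∧ IsHilbertFrame (gaborSystem g hg p.1 p.2)}

/-- The characteristic function of `[-1/2, 1/2]`. -/
noncomputable def unitBox : ℝ → ℝ :=
  Set.indicator (Set.Icc (-(1 / 2)) (1 / 2)) (fun _ => 1)

/-- The B-splines `B₁ = χ_{[-1/2, 1/2]}`, `B_{N+1} = B_N * B₁`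
(with the unused convention `B₀ = 0`). -/
noncomputable def bSpline : ℕ → ℝ → ℝ
  | 0 => 0
  | 1 => unitBox
  | N + 2 => convolution (bSpline (N + 1)) unitBox (ContinuousLinearMap.mul ℝ ℝ) volume

theorem bSpline_succ (N : ℕ) (hN : 1 ≤ N) (x : ℝ) :
    bSpline (N + 1) x = ∫ t, bSpline N t * bSpline 1 (x - t) := by
  obtain ⟨k, rfl⟩ : ∃ k, N = k + 1 := ⟨N - 1, by omega⟩
  simp [bSpline, convolution]

theorem integrable_unitBox : Integrable unitBox volume := by
  unfold unitBox
  rw [integrable_indicator_iff measurableSet_Icc]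
  exact integrableOn_const (by simp)

theorem norm_unitBox_le (x : ℝ) : ‖unitBox x‖ ≤ 1 := by
  unfold unitBox
  by_cases h : x ∈ Set.Icc (-(1 / 2) : ℝ) (1 / 2)
  · rw [Set.indicator_of_mem h]; simp
  · rw [Set.indicator_of_notMem h]; simp

theorem bSpline_bounds (N : ℕ) :
    Integrable (bSpline N) volume ∧ ∃ C : ℝ, ∀ x, ‖bSpline N x‖ ≤ C := by
  induction N using bSpline.induct with
  | case1 => exact ⟨by simp [bSpline], 0, by simp [bSpline]⟩
  | case2 => exact ⟨by simpa [bSpline] using integrable_unitBox, 1, by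
      simpa [bSpline] using norm_unitBox_le⟩
  | case3 N ih =>
    obtain ⟨hi, -⟩ := ih
    refine ⟨?_, ∫ t, ‖bSpline (N + 1) t‖, fun x => ?_⟩
    · rw [bSpline]
      exact hi.integrable_convolution _ integrable_unitBox
    · rw [bSpline]
      refine norm_integral_le_of_norm_le hi.norm (Filter.Eventually.of_forall fun t => ?_)
      rw [ContinuousLinearMap.mul_apply', norm_mul]
      exact mul_le_of_le_one_right (norm_nonneg _) (norm_unitBox_le _)

/-- The B-spline `B_N` as a complex-valued window. -/
noncomputable def bSplineWindow (N : ℕ) (x : ℝ) : ℂ := (bSpline N x : ℂ)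

theorem memLp_bSplineWindow (N : ℕ) : MemLp (bSplineWindow N) 2 volume := by
  obtain ⟨hi, C, hC⟩ := bSpline_bounds N
  have hw : Integrable (bSplineWindow N) volume := hi.ofReal
  rw [memLp_two_iff_integrable_sq_norm hw.aestronglyMeasurable]
  refine (hi.norm.const_mul C).mono' (hw.aestronglyMeasurable.norm.pow 2)
    (Filter.Eventually.of_forall fun x => ?_)
  have h : ‖bSplineWindow N x‖ = ‖bSpline N x‖ := Complex.norm_real _
  rw [h, norm_pow, norm_norm, sq]
  exact mul_le_mul_of_nonneg_right (hC x) (norm_nonneg _)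

/-- The Gabor frame set of the B-spline `B_N`. -/
def bSplineFrameSet (N : ℕ) : Set (ℝ × ℝ) :=
  gaborFrameSet (bSplineWindow N) (memLp_bSplineWindow N)

/-- The set of `(a, b)` with `a, b > 0`, `a < N`, `a b < 1` and `b ∉ {2, 3, …}`. -/
def grochenigSet (N : ℕ) : Set (ℝ × ℝ) :=
  {p | 0 < p.1 ∧ 0 < p.2 ∧ p.1 < N ∧ p.1 * p.2 < 1 ∧ ∀ k : ℕ, 2 ≤ k → p.2 ≠ k}

/-! Folding `ℝ` modulo `1/b` and applying Parseval in the modulation index turns the frame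
inequalities into uniform `ℓ²` bounds for the matrices `(g (x + k/b - n a))`, with rows `n` and
columns `k`. For a continuous compactly supported window the upper bound is automatic, and a frame
lower bound transfers to every `x`, tested on finitely supported vectors.

Necessity: each excluded case yields a kernel vector. A column vanishes when `a ≥ N`; there are more
columns than rows when `ab > 1`; evenness kills `(-1)^k` when `ab = 1`; the partition of unity kills
the powers of an `m`-th root of unity when `b = m ≥ 2`. The last two vectors are only bounded, and
long truncations of them violate the lower bound.

Sufficiency: the system for `M a` is a subfamily of the one for `a`, so a frame at `(M a, b)` gives
one at `(a, b)`. Doubling `a` reaches either `1/2 ≤ ab < 1` with `a < N/2`, which is the hypothesis,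
or `N/2 ≤ a < N`. In the latter range strict decrease of `B_N` on `[0, N/2]` makes a tridiagonal
submatrix uniformly diagonally dominant. Since `b` never changes, the argument works for each `b`
separately. -/

/-! ### B-splines: partition of unity and monotone shape. -/

theorem bSpline_eq_setIntegral (N : ℕ) (x : ℝ) :
    bSpline (N + 2) x = ∫ t in Set.Icc (x - 1 / 2) (x + 1 / 2), bSpline (N + 1) t := by
  rw [← integral_indicator measurableSet_Icc, bSpline, convolution]
  refine integral_congr_ae (Filter.Eventually.of_forall fun t => ?_)
  simp only [ContinuousLinearMap.mul_apply', unitBox, Set.indicator_apply, Set.mem_Icc]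
  have h : (-(1 / 2) ≤ x - t ∧ x - t ≤ 1 / 2) ↔ (x - 1 / 2 ≤ t ∧ t ≤ x + 1 / 2) := by
    constructor <;> rintro ⟨h1, h2⟩ <;> constructor <;> linarith
  simp only [h, mul_ite, mul_one, mul_zero]

theorem bSpline_eq_intervalIntegral (N : ℕ) (x : ℝ) :
    bSpline (N + 2) x = ∫ t in (x - 1 / 2)..(x + 1 / 2), bSpline (N + 1) t := by
  rw [bSpline_eq_setIntegral, integral_Icc_eq_integral_Ioc,
    intervalIntegral.integral_of_le (by linarith)]

theorem bSpline_two (x : ℝ) : bSpline 2 x = max 0 (1 - |x|) := by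
  rw [bSpline_eq_setIntegral 0 x]
  simp only [bSpline, unitBox]
  rw [setIntegral_indicator measurableSet_Icc, Set.Icc_inter_Icc]
  simp only [integral_const, MeasurableSet.univ, measureReal_restrict_apply, Set.univ_inter,
    smul_eq_mul, mul_one, Real.volume_real_Icc]
  rw [max_comm]
  congr 1
  simp only [max_def, min_def, abs]
  split_ifs <;> linarith

theorem integral_bSpline (N : ℕ) : ∫ t, bSpline (N + 1) t = 1 := by
  induction N with
  | zero =>
    simp only [bSpline, unitBox]
    rw [integral_indicator measurableSet_Icc]
    norm_num
  | succ N ih =>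
    have h1 : ∫ t, unitBox t = 1 := by
      unfold unitBox
      rw [integral_indicator measurableSet_Icc]
      norm_num
    rw [bSpline, MeasureTheory.integral_convolution _ (bSpline_bounds (N + 1)).1
      integrable_unitBox, ih, h1]
    simp

/-- The translates are integrals of the preceding spline over consecutive unit intervals, which tile
the line, and that spline has total mass one. -/
theorem hasSum_bSpline_int_translates (N : ℕ) (x : ℝ) :
    HasSum (fun k : ℤ => bSpline (N + 2) (x + k)) 1 := by
  rw [← integral_bSpline N]
  have h : (fun k : ℤ => bSpline (N + 2) (x + k)) = fun k : ℤ =>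
      ∫ t in (x - 1 / 2 + k)..(x - 1 / 2 + k + 1), bSpline (N + 1) t := by
    funext k
    rw [bSpline_eq_intervalIntegral]
    congr 1 <;> ring
  rw [h]
  exact (bSpline_bounds (N + 1)).1.hasSum_intervalIntegral (x - 1 / 2)

/-- Induction from the hat function, using `B_{N+1}'(x) = B_N(x + 1/2) - B_N(x - 1/2)`. For `x > 0`
the point `x - 1/2` is closer to the origin than `x + 1/2`, so evenness and monotonicity of `B_N`
make the derivative negative. -/
theorem bSpline_shape (N : ℕ) :
    Continuous (bSpline (N + 2)) ∧ (∀ x, bSpline (N + 2) (-x) = bSpline (N + 2) x) ∧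
      (∀ x, ((N + 2 : ℕ) : ℝ) / 2 ≤ |x| → bSpline (N + 2) x = 0) ∧
      StrictAntiOn (bSpline (N + 2)) (Set.Icc 0 (((N + 2 : ℕ) : ℝ) / 2)) := by
  induction N with
  | zero =>
    have h : bSpline 2 = fun x => max 0 (1 - |x|) := funext bSpline_two
    simp only [zero_add, h]
    refine ⟨by fun_prop, by simp, fun x hx => ?_, fun x hx y hy hxy => ?_⟩
    · norm_num at hx
      exact max_eq_left (by linarith)
    · norm_num at hx hy
      simp only [abs_of_nonneg hx.1, abs_of_nonneg hy.1]
      rw [max_eq_right (by linarith : 0 ≤ 1 - y)]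
      exact lt_max_of_lt_right (by linarith)
  | succ N ih =>
    obtain ⟨hc, he, hs, ha⟩ := ih
    have hab : ∀ t, bSpline (N + 2) |t| = bSpline (N + 2) t := fun t => by
      rcases abs_choice t with h | h <;> rw [h]
      exact he t
    have hform := bSpline_eq_intervalIntegral (N + 1)
    have hd : ∀ x, HasDerivAt (bSpline (N + 3))
        (bSpline (N + 2) (x + 1 / 2) - bSpline (N + 2) (x - 1 / 2)) x := by
      intro x
      have hP : ∀ y, HasDerivAt (fun u => ∫ t in (0 : ℝ)..u, bSpline (N + 2) t)
          (bSpline (N + 2) y) y := fun y =>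
        intervalIntegral.integral_hasDerivAt_right (hc.intervalIntegrable _ _)
          (hc.stronglyMeasurableAtFilter _ _) hc.continuousAt
      have h1 := (hP (x + 1 / 2)).comp_add_const x (1 / 2)
      have h2 := (hP (x - 1 / 2)).comp_sub_const x (1 / 2)
      refine (h1.sub h2).congr_of_eventuallyEq (Filter.Eventually.of_forall fun y => ?_)
      simp only [Pi.sub_apply]
      rw [hform, intervalIntegral.integral_interval_sub_left (hc.intervalIntegrable _ _)
        (hc.intervalIntegrable _ _)]
    have hcont : Continuous (bSpline (N + 3)) :=
      continuous_iff_continuousAt.2 fun x => (hd x).continuousAt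
    refine ⟨hcont, fun x => ?_, fun x hx => ?_, ?_⟩
    · have h := intervalIntegral.integral_comp_neg (a := x - 1 / 2) (b := x + 1 / 2)
        (bSpline (N + 2))
      simp only [he] at h
      rw [hform, hform, h]
      congr 1 <;> ring
    · rw [hform]
      refine (intervalIntegral.integral_congr fun t ht => hs t ?_).trans
        intervalIntegral.integral_zero
      rw [Set.uIcc_of_le (by linarith), Set.mem_Icc] at ht
      push_cast at hx ⊢
      rcases le_abs.1 hx with h | h
      · exact le_abs.2 (Or.inl (by linarith [ht.1]))
      · exact le_abs.2 (Or.inr (by linarith [ht.2]))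
    · refine strictAntiOn_of_deriv_neg (convex_Icc _ _) hcont.continuousOn fun x hx => ?_
      rw [interior_Icc, Set.mem_Ioo] at hx
      obtain ⟨hx0, hx1⟩ := hx
      push_cast at hx1
      rw [(hd x).deriv, sub_neg, ← hab (x - 1 / 2)]
      have h1 : |x - 1 / 2| < x + 1 / 2 := abs_lt.2 ⟨by linarith, by linarith⟩
      have h2 : |x - 1 / 2| < ((N + 2 : ℕ) : ℝ) / 2 := by
        have : (0 : ℝ) ≤ N := Nat.cast_nonneg N
        push_cast
        exact abs_lt.2 ⟨by linarith, by linarith⟩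
      rcases le_total (x + 1 / 2) (((N + 2 : ℕ) : ℝ) / 2) with h | h
      · exact ha ⟨abs_nonneg _, h2.le⟩ ⟨by linarith, h⟩ h1
      -- Beyond the support, the value zero is also the value at the endpoint, where strict decrease
      -- still applies.
      · rw [hs (x + 1 / 2) (h.trans (le_abs_self _)),
          ← hs (((N + 2 : ℕ) : ℝ) / 2) (le_abs_self _)]
        exact ha ⟨abs_nonneg _, h2.le⟩ ⟨by positivity, le_rfl⟩ h2

/-! ### Lattice counting, fiber matrix and periodization. -/

/-- The integers `k` with `|k p - u| ≤ r`. -/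
noncomputable def intWindow (p u r : ℝ) : Finset ℤ :=
  Finset.Icc ⌈(u - r) / p⌉ ⌊(u + r) / p⌋

theorem mem_intWindow {p : ℝ} (hp : 0 < p) (u r : ℝ) (k : ℤ) :
    k ∈ intWindow p u r ↔ |k * p - u| ≤ r := by
  rw [intWindow, Finset.mem_Icc, Int.ceil_le, Int.le_floor, div_le_iff₀ hp, le_div_iff₀ hp, abs_le]
  constructor <;> rintro ⟨h1, h2⟩ <;> constructor <;> linarith

theorem card_intWindow_le {p r : ℝ} (hp : 0 < p) (hr : 0 ≤ r) (u : ℝ) :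
    ((intWindow p u r).card : ℝ) ≤ 2 * r / p + 1 := by
  have h0 : (0 : ℝ) ≤ 2 * r / p + 1 := by positivity
  have h1 : ((⌊(u + r) / p⌋ : ℤ) : ℝ) ≤ (u + r) / p := Int.floor_le _
  have h2 : (u - r) / p ≤ ⌈(u - r) / p⌉ := Int.le_ceil _
  have h3 : (u + r) / p - (u - r) / p = 2 * r / p := by ring
  have h4 : (((⌊(u + r) / p⌋ + 1 - ⌈(u - r) / p⌉).toNat : ℤ) : ℝ) ≤ 2 * r / p + 1 := by
    rw [Int.toNat_eq_max, Int.cast_max]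
    refine max_le ?_ (by simpa using h0)
    push_cast
    linarith
  rw [Int.cast_natCast] at h4
  rwa [intWindow, Int.card_Icc]

/-- The `n`-th entry of the Ron–Shen fiber matrix at `x`, applied to `c`. -/
noncomputable def gaborFiber (g : ℝ → ℂ) (a b : ℝ) (c : ℤ → ℂ) (x : ℝ) (n : ℤ) : ℂ :=
  ∑' k : ℤ, c k * g (x + k / b - n * a)

theorem gaborFiber_eq_sum {g : ℝ → ℂ} {a b : ℝ} {S : Finset ℤ} (c : ℤ → ℂ) {x : ℝ} {n : ℤ}
    (hS : ∀ k ∉ S, c k * g (x + k / b - n * a) = 0) :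
    gaborFiber g a b c x n = ∑ k ∈ S, c k * g (x + k / b - n * a) :=
  tsum_eq_sum hS

theorem pairwise_disjoint_Ioc_add_mul {p : ℝ} (t : ℝ) :
    Pairwise (Function.onFun Disjoint fun k : ℤ => Set.Ioc (t + k * p) (t + (k + 1) * p)) := by
  have h := Set.pairwise_disjoint_Ioc_add_zsmul t p
  simpa only [zsmul_eq_mul, Int.cast_add, Int.cast_one] using h

theorem iUnion_Ioc_add_mul {p : ℝ} (hp : 0 < p) (t : ℝ) :
    ⋃ k : ℤ, Set.Ioc (t + k * p) (t + (k + 1) * p) = Set.univ := by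
  have h := iUnion_Ioc_add_zsmul hp t
  simpa only [zsmul_eq_mul, Int.cast_add, Int.cast_one] using h

theorem lintegral_eq_lintegral_tsum_translates {p : ℝ} (hp : 0 < p) (t : ℝ) {u : ℝ → ENNReal}
    (hu : Measurable u) :
    ∫⁻ x, u x = ∫⁻ x in Set.Ioc t (t + p), ∑' k : ℤ, u (x + k * p) := by
  rw [lintegral_tsum fun k => by fun_prop, ← setLIntegral_univ, ← iUnion_Ioc_add_mul hp t,
    lintegral_iUnion (fun _ => measurableSet_Ioc) (pairwise_disjoint_Ioc_add_mul t)]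
  refine tsum_congr fun k => ?_
  have h := (measurePreserving_add_right volume ((k : ℝ) * p)).setLIntegral_comp_preimage
    (measurableSet_Ioc (a := t + k * p) (b := t + (k + 1) * p)) hu
  rw [← h, Set.preimage_add_const_Ioc]
  congr 3 <;> ring

theorem hasSum_setIntegral_translates {p : ℝ} (hp : 0 < p) (t : ℝ) {u : ℝ → ℂ}
    (hu : Integrable u) :
    HasSum (fun k : ℤ => ∫ x in Set.Ioc t (t + p), u (x + k * p)) (∫ x, u x) := by
  have h := hasSum_integral_iUnion (fun _ => measurableSet_Ioc)
    (pairwise_disjoint_Ioc_add_mul (p := p) t) (hu.integrableOn (μ := volume))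
  rw [iUnion_Ioc_add_mul hp t, setIntegral_univ] at h
  refine (congrArg (HasSum · (∫ x, u x)) (funext fun k => ?_)).mpr h
  have h := (measurePreserving_add_right volume ((k : ℝ) * p)).setIntegral_preimage_emb
    (measurableEmbedding_addRight _) u (Set.Ioc (t + k * p) (t + (k + 1) * p))
  rw [← h, Set.preimage_add_const_Ioc]
  congr 3 <;> ring

theorem exp_modulation_add (b x : ℝ) (hb : b ≠ 0) (m k : ℤ) :
    Complex.exp (2 * (Real.pi : ℂ) * Complex.I * ((m * b * (x + k * (1 / b)) : ℝ) : ℂ)) =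
      Complex.exp (2 * (Real.pi : ℂ) * Complex.I * ((m * b * x : ℝ) : ℂ)) := by
  rw [Complex.exp_eq_exp_iff_exists_int]
  refine ⟨m * k, ?_⟩
  have hb' : (b : ℂ) ≠ 0 := by exact_mod_cast hb
  push_cast
  field_simp

/-- Standing assumptions on a window: continuous, supported in `[-R, R]`. -/
structure IsCompactWindow (g : ℝ → ℂ) (R : ℝ) : Prop where
  continuous : Continuous g
  pos : 0 < R
  eq_zero : ∀ x, R ≤ |x| → g x = 0

namespace IsCompactWindow

variable {g : ℝ → ℂ} {R a b : ℝ}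

theorem exists_bound (h : IsCompactWindow g R) : ∃ C : ℝ, 0 < C ∧ ∀ x, ‖g x‖ ≤ C := by
  obtain ⟨C, hC⟩ := (isCompact_Icc (a := -R) (b := R)).exists_bound_of_continuousOn
    h.continuous.continuousOn
  refine ⟨max C 1, by positivity, fun x => ?_⟩
  by_cases hx : R ≤ |x|
  · rw [h.eq_zero x hx, norm_zero]
    positivity
  · exact (hC x (abs_le.1 (not_le.1 hx).le)).trans (le_max_left _ _)

theorem eq_zero_of_notMem (h : IsCompactWindow g R) (hb : 0 < b) {t x : ℝ}
    (hx : x ∈ Set.Icc t (t + 1 / b)) {n k : ℤ}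
    (hk : k ∉ intWindow (1 / b) (n * a - t) (R + 1 / b)) : g (x + k / b - n * a) = 0 := by
  refine h.eq_zero _ (le_of_not_gt fun hlt => hk ?_)
  rw [mem_intWindow (by positivity), abs_le]
  rw [abs_lt] at hlt
  have e : (k : ℝ) * (1 / b) = k / b := by ring
  rw [e]
  constructor <;> linarith [hx.1, hx.2]

theorem gaborFiber_eq_sum_intWindow (h : IsCompactWindow g R) (hb : 0 < b) (c : ℤ → ℂ) {t x : ℝ}
    (hx : x ∈ Set.Icc t (t + 1 / b)) (n : ℤ) :
    gaborFiber g a b c x n =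
      ∑ k ∈ intWindow (1 / b) (n * a - t) (R + 1 / b), c k * g (x + k / b - n * a) :=
  gaborFiber_eq_sum c fun k hk => by rw [h.eq_zero_of_notMem hb hx hk, mul_zero]

end IsCompactWindow

/-! ### Fiberization of the frame inequalities. -/

theorem inner_gaborSystem {g : ℝ → ℂ} (hg : MemLp g 2 volume) (a b : ℝ)
    (f : Lp ℂ 2 (volume : Measure ℝ)) (m n : ℤ) :
    ⟪f, gaborSystem g hg a b (m, n)⟫_ℂ =
      ∫ x, starRingEnd ℂ (f x) * gaborAtom g a b m n x := by
  rw [L2.inner_def]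
  refine integral_congr_ae ?_
  filter_upwards [(memLp_gaborAtom hg a b m n).coeFn_toLp] with x hx
  simp only [gaborSystem, hx, RCLike.inner_apply]
  ring

/-- The modulations have period `1/b`, so for fixed `n` the inner products are multiples of the
Fourier coefficients of the `1/b`-periodization of `conj f · g(· - n a)`, and Parseval applies. `H`
is this periodization cut to the finitely many shifts that matter on the chosen period, so its
square integrability is immediate. -/
theorem hasSum_sq_inner_gaborSystem {g : ℝ → ℂ} {R a b : ℝ} (hw : IsCompactWindow g R)
    (hg : MemLp g 2 volume) (hb : 0 < b) (f : Lp ℂ 2 (volume : Measure ℝ)) (t : ℝ) (n : ℤ) :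
    ∃ H : ℝ → ℂ, MemLp H 2 (volume.restrict (Set.Ioc t (t + 1 / b))) ∧
      (∀ x ∈ Set.Ioc t (t + 1 / b),
        H x = gaborFiber g a b (fun k => starRingEnd ℂ (f (x + k / b))) x n) ∧
      HasSum (fun m : ℤ => ‖⟪f, gaborSystem g hg a b (m, n)⟫_ℂ‖ ^ 2)
        (1 / b * ∫ x in Set.Ioc t (t + 1 / b), ‖H x‖ ^ 2) := by
  obtain ⟨C, hC0, hC⟩ := hw.exists_bound
  have hb1 : 0 < 1 / b := by positivity
  set S := intWindow (1 / b) (n * a - t) (R + 1 / b) with hS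
  set h : ℝ → ℂ := fun x => starRingEnd ℂ (f x) * g (x - n * a) with hh
  have hgs : Continuous fun x : ℝ => g (x - n * a) :=
    hw.continuous.comp (continuous_id.sub continuous_const)
  have hmem : MemLp h 2 volume := by
    refine ((Lp.memLp f).norm.const_mul C).mono ?_ (Filter.Eventually.of_forall fun x => ?_)
    · exact ((RCLike.continuous_conj.comp_aestronglyMeasurable
        (Lp.aestronglyMeasurable f)).mul hgs.aestronglyMeasurable)
    · rw [hh]
      simp only [norm_mul, RCLike.norm_conj, Real.norm_eq_abs, abs_norm, abs_of_pos hC0]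
      rw [mul_comm]
      exact mul_le_mul_of_nonneg_right (hC _) (norm_nonneg _)
  have hmemk : ∀ k : ℤ, MemLp (fun x => h (x + k * (1 / b))) 2 volume := fun k =>
    hmem.comp_measurePreserving (measurePreserving_add_right volume ((k : ℝ) * (1 / b)))
  set H : ℝ → ℂ := fun x => ∑ k ∈ S, h (x + k * (1 / b)) with hH
  have hHmem : MemLp H 2 (volume.restrict (Set.Ioc t (t + 1 / b))) :=
    memLp_finsetSum _ fun k _ => (hmemk k).restrict _
  refine ⟨H, hHmem, fun x hx => ?_, ?_⟩
  · rw [hw.gaborFiber_eq_sum_intWindow hb _ (Set.Ioc_subset_Icc_self hx), hH]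
    refine Finset.sum_congr rfl fun k _ => ?_
    simp only [hh, mul_one_div]
  have hlt : t < t + 1 / b := by linarith
  have key : ∀ m : ℤ, ⟪f, gaborSystem g hg a b (m, n)⟫_ℂ =
      (1 / b : ℝ) • fourierCoeffOn hlt H (-m) := by
    intro m
    set E : ℝ → ℂ := fun x =>
      Complex.exp (2 * (Real.pi : ℂ) * Complex.I * ((m * b * x : ℝ) : ℂ)) with hE
    have hint : Integrable (fun x => h x * E x) volume := by
      have h1 : Integrable (fun x => starRingEnd ℂ (f x) * gaborAtom g a b m n x) volume :=
        (Lp.memLp f).star.integrable_mul (memLp_gaborAtom hg a b m n)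
      refine h1.congr (Filter.Eventually.of_forall fun x => ?_)
      simp only [hh, hE, gaborAtom]
      ring
    have hsum := hasSum_setIntegral_translates hb1 t hint
    have hzero : ∀ k ∉ S, ∫ x in Set.Ioc t (t + 1 / b),
        h (x + k * (1 / b)) * E (x + k * (1 / b)) = 0 := fun k hk => by
      refine setIntegral_eq_zero_of_forall_eq_zero fun x hx => ?_
      simp only [hh, mul_one_div]
      rw [hw.eq_zero_of_notMem hb (Set.Ioc_subset_Icc_self hx) hk, mul_zero, zero_mul]
    rw [inner_gaborSystem]
    have e1 : ∫ x, starRingEnd ℂ (f x) * gaborAtom g a b m n x = ∫ x, h x * E x := by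
      refine integral_congr_ae (Filter.Eventually.of_forall fun x => ?_)
      simp only [hh, hE, gaborAtom]
      ring
    rw [e1, ← hsum.tsum_eq, tsum_eq_sum hzero, ← integral_finsetSum]
    · rw [fourierCoeffOn_eq_integral, add_sub_cancel_left, smul_smul,
        intervalIntegral.integral_of_le hlt.le]
      have e2 : 1 / b * (1 / (1 / b)) = 1 := by field_simp
      rw [e2, one_smul]
      refine integral_congr_ae (Filter.Eventually.of_forall fun x => ?_)
      simp only [neg_neg, hH, hE, smul_eq_mul, fourier_coe_apply, Finset.mul_sum]
      refine Finset.sum_congr rfl fun k _ => ?_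
      rw [exp_modulation_add b x hb.ne', mul_comm]
      congr 2
      have hb' : (b : ℂ) ≠ 0 := by exact_mod_cast hb.ne'
      push_cast
      field_simp
    · intro k _
      exact ((measurePreserving_add_right volume ((k : ℝ) * (1 / b))).integrable_comp_emb
        (measurableEmbedding_addRight _)).2 hint |>.integrableOn
  have hP := hasSum_sq_fourierCoeffOn hlt hHmem
  have hP' := ((Equiv.neg ℤ).hasSum_iff.2 hP).mul_left ((1 / b) ^ 2)
  rw [intervalIntegral.integral_of_le hlt.le] at hP'
  have e1 : (fun m : ℤ => ‖⟪f, gaborSystem g hg a b (m, n)⟫_ℂ‖ ^ 2) = fun m =>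
      (1 / b) ^ 2 * ((fun i => ‖fourierCoeffOn hlt H i‖ ^ 2) ∘ (Equiv.neg ℤ)) m := by
    funext m
    simp only [key m, norm_smul, Function.comp_apply, Equiv.neg_apply, mul_pow, Real.norm_eq_abs,
      sq_abs]
  -- Parseval for normalized coefficients carries the inverse period `b`; with the squared factor
  -- `(1/b)²` this leaves `1/b`.
  have e2 : 1 / b = (1 / b) ^ 2 * (t + 1 / b - t)⁻¹ := by
    rw [add_sub_cancel_left]
    field_simp
  rw [e1, show (1 / b * ∫ x in Set.Ioc t (t + 1 / b), ‖H x‖ ^ 2) = (1 / b) ^ 2 *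
    (t + 1 / b - t)⁻¹ • ∫ x in Set.Ioc t (t + 1 / b), ‖H x‖ ^ 2 by
      rw [smul_eq_mul, ← mul_assoc, ← e2]]
  exact hP'

/-- In `ENNReal`, summability need not be tracked: the upper bound forces it. -/
theorem isHilbertFrame_iff_enorm {ι H : Type*} [NormedAddCommGroup H] [InnerProductSpace ℂ H]
    (e : ι → H) :
    IsHilbertFrame e ↔ ∃ A B : ℝ, 0 < A ∧ 0 < B ∧ ∀ f : H,
      ENNReal.ofReal A * ‖f‖ₑ ^ 2 ≤ ∑' i, ‖⟪f, e i⟫_ℂ‖ₑ ^ 2 ∧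
        ∑' i, ‖⟪f, e i⟫_ℂ‖ₑ ^ 2 ≤ ENNReal.ofReal B * ‖f‖ₑ ^ 2 := by
  have hconv : ∀ f : H, ∀ C : ℝ, 0 < C →
      ENNReal.ofReal C * ‖f‖ₑ ^ 2 = ENNReal.ofReal (C * ‖f‖ ^ 2) := fun f C hC => by
    rw [ENNReal.ofReal_mul hC.le, ENNReal.ofReal_pow (norm_nonneg _), ofReal_norm]
  have hterm : ∀ f : H, ∀ i, ‖⟪f, e i⟫_ℂ‖ₑ ^ 2 = ENNReal.ofReal (‖⟪f, e i⟫_ℂ‖ ^ 2) :=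
    fun f i => by rw [ENNReal.ofReal_pow (norm_nonneg _), ofReal_norm]
  constructor
  · rintro ⟨A, B, hA, hB, h⟩
    refine ⟨A, B, hA, hB, fun f => ?_⟩
    obtain ⟨hs, h1, h2⟩ := h f
    simp only [hterm, hconv f A hA, hconv f B hB]
    rw [← ENNReal.ofReal_tsum_of_nonneg (fun _ => by positivity) hs]
    exact ⟨ENNReal.ofReal_le_ofReal h1, ENNReal.ofReal_le_ofReal h2⟩
  · rintro ⟨A, B, hA, hB, h⟩
    refine ⟨A, B, hA, hB, fun f => ?_⟩
    obtain ⟨h1, h2⟩ := h f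
    simp only [hterm, hconv f A hA, hconv f B hB] at h1 h2
    have hs : Summable fun i => ‖⟪f, e i⟫_ℂ‖ ^ 2 := by
      have := ENNReal.summable_toReal (ne_top_of_le_ne_top ENNReal.ofReal_ne_top h2)
      simpa only [ENNReal.toReal_ofReal (sq_nonneg _)] using this
    rw [← ENNReal.ofReal_tsum_of_nonneg (fun _ => by positivity) hs] at h1 h2
    have h0 : 0 ≤ ∑' i, ‖⟪f, e i⟫_ℂ‖ ^ 2 := tsum_nonneg fun _ => by positivity
    exact ⟨hs, (ENNReal.ofReal_le_ofReal_iff h0).1 h1,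
      (ENNReal.ofReal_le_ofReal_iff (by positivity)).1 h2⟩

theorem enorm_sq_Lp_two (f : Lp ℂ 2 (volume : Measure ℝ)) : ‖f‖ₑ ^ 2 = ∫⁻ x, ‖f x‖ₑ ^ 2 := by
  rw [Lp.enorm_def, eLpNorm_eq_lintegral_rpow_enorm_toReal (by norm_num) (by norm_num)]
  rw [← ENNReal.rpow_natCast, ← ENNReal.rpow_mul]
  norm_num

theorem enorm_sq_Lp_two_eq_translates {b : ℝ} (hb : 0 < b) (f : Lp ℂ 2 (volume : Measure ℝ))
    (t : ℝ) :
    ‖f‖ₑ ^ 2 = ∫⁻ x in Set.Ioc t (t + 1 / b), ∑' k : ℤ, ‖f (x + k / b)‖ₑ ^ 2 := by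
  have hf : Measurable f := (Lp.stronglyMeasurable f).measurable
  rw [enorm_sq_Lp_two, lintegral_eq_lintegral_tsum_translates (by positivity : 0 < 1 / b) t
    (by fun_prop)]
  simp only [mul_one_div]

/-- Fiberization of the Gabor analysis operator. -/
theorem tsum_enorm_sq_inner_gaborSystem {g : ℝ → ℂ} {R a b : ℝ} (hw : IsCompactWindow g R)
    (hg : MemLp g 2 volume) (hb : 0 < b) (f : Lp ℂ 2 (volume : Measure ℝ)) (t : ℝ) :
    ∑' p : ℤ × ℤ, ‖⟪f, gaborSystem g hg a b p⟫_ℂ‖ₑ ^ 2 =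
      ENNReal.ofReal (1 / b) * ∫⁻ x in Set.Ioc t (t + 1 / b),
        ∑' n : ℤ, ‖gaborFiber g a b (fun k => starRingEnd ℂ (f (x + k / b))) x n‖ₑ ^ 2 := by
  choose H hH hHeq hHsum using hasSum_sq_inner_gaborSystem (a := a) hw hg hb f t
  have h1 : ∫⁻ x in Set.Ioc t (t + 1 / b),
      ∑' n : ℤ, ‖gaborFiber g a b (fun k => starRingEnd ℂ (f (x + k / b))) x n‖ₑ ^ 2 =
      ∫⁻ x in Set.Ioc t (t + 1 / b), ∑' n : ℤ, ‖H n x‖ₑ ^ 2 :=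
    setLIntegral_congr_fun measurableSet_Ioc fun x hx =>
      tsum_congr fun n => by rw [hHeq n x hx]
  rw [h1, lintegral_tsum fun n => (hH n).aestronglyMeasurable.enorm.pow_const 2,
    ← ENNReal.tsum_mul_left, ← (Equiv.prodComm ℤ ℤ).tsum_eq]
  simp only [Equiv.prodComm_apply, Prod.swap]
  rw [ENNReal.tsum_prod (f := fun n m : ℤ => ‖⟪f, gaborSystem g hg a b (m, n)⟫_ℂ‖ₑ ^ 2)]
  refine tsum_congr fun n => ?_
  have hint : Integrable (fun x => ‖H n x‖ ^ 2) (volume.restrict (Set.Ioc t (t + 1 / b))) :=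
    (memLp_two_iff_integrable_sq_norm (hH n).aestronglyMeasurable).1 (hH n)
  have hterm : ∀ z : ℂ, ‖z‖ₑ ^ 2 = ENNReal.ofReal (‖z‖ ^ 2) :=
    fun z => by rw [ENNReal.ofReal_pow (norm_nonneg _), ofReal_norm]
  simp only [hterm]
  rw [← ofReal_integral_eq_lintegral_ofReal hint
    (Filter.Eventually.of_forall fun _ => by positivity), ← ENNReal.ofReal_mul (by positivity),
    ← (hHsum n).tsum_eq, ENNReal.ofReal_tsum_of_nonneg (fun _ => by positivity) (hHsum n).summable]

theorem isHilbertFrame_of_fiber_bounds {g : ℝ → ℂ} {R a b : ℝ} (hw : IsCompactWindow g R)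
    (hg : MemLp g 2 volume) (hb : 0 < b)
    (hU : ∃ B : ℝ, 0 < B ∧ ∀ (x : ℝ) (c : ℤ → ℂ),
      ∑' n : ℤ, ‖gaborFiber g a b c x n‖ₑ ^ 2 ≤ ENNReal.ofReal B * ∑' k, ‖c k‖ₑ ^ 2)
    (hL : ∃ A : ℝ, 0 < A ∧ ∀ (x : ℝ) (c : ℤ → ℂ), ∑' k, ‖c k‖ₑ ^ 2 ≠ ⊤ →
      ENNReal.ofReal A * ∑' k, ‖c k‖ₑ ^ 2 ≤ ∑' n : ℤ, ‖gaborFiber g a b c x n‖ₑ ^ 2) :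
    IsHilbertFrame (gaborSystem g hg a b) := by
  obtain ⟨A, hA, hL⟩ := hL
  obtain ⟨B, hB, hU⟩ := hU
  rw [isHilbertFrame_iff_enorm]
  refine ⟨1 / b * A, 1 / b * B, by positivity, by positivity, fun f => ?_⟩
  have hf : Measurable f := (Lp.stronglyMeasurable f).measurable
  have hn := enorm_sq_Lp_two_eq_translates hb f 0
  have hconj : ∀ (x : ℝ) (k : ℤ), ‖starRingEnd ℂ (f (x + k / b))‖ₑ = ‖f (x + k / b)‖ₑ :=
    fun x k => by rw [← ofReal_norm, RCLike.norm_conj, ofReal_norm]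
  have hmeas : Measurable fun x => ∑' k : ℤ, ‖f (x + k / b)‖ₑ ^ 2 := by fun_prop
  rw [tsum_enorm_sq_inner_gaborSystem hw hg hb f 0, ENNReal.ofReal_mul (by positivity),
    ENNReal.ofReal_mul (by positivity), mul_assoc, mul_assoc]
  refine ⟨mul_le_mul_right ?_ _, mul_le_mul_right ?_ _⟩
  · rw [hn, ← lintegral_const_mul _ hmeas]
    have hfin : ∀ᵐ x ∂(volume.restrict (Set.Ioc (0 : ℝ) (0 + 1 / b))),
        ∑' k : ℤ, ‖f (x + k / b)‖ₑ ^ 2 < ⊤ := by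
      refine ae_lt_top hmeas ?_
      rw [← hn]
      simp
    refine lintegral_mono_ae ?_
    filter_upwards [hfin] with x hx
    have := hL x (fun k => starRingEnd ℂ (f (x + k / b)))
    simp only [hconj] at this
    exact this hx.ne
  · rw [hn, ← lintegral_const_mul _ hmeas]
    refine lintegral_mono fun x => ?_
    have := hU x (fun k => starRingEnd ℂ (f (x + k / b)))
    simpa only [hconj] using this

/-- Schur-type bound: entries are at most `C`, each row has at most `K` nonzero entries
(Cauchy–Schwarz), and each column meets at most `L` rows. -/
theorem tsum_enorm_sq_gaborFiber_le {g : ℝ → ℂ} {R a b : ℝ} (hw : IsCompactWindow g R)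
    (ha : 0 < a) (hb : 0 < b) :
    ∃ B : ℝ, 0 < B ∧ ∀ (x : ℝ) (c : ℤ → ℂ),
      ∑' n : ℤ, ‖gaborFiber g a b c x n‖ₑ ^ 2 ≤ ENNReal.ofReal B * ∑' k, ‖c k‖ₑ ^ 2 := by
  obtain ⟨C, hC0, hC⟩ := hw.exists_bound
  have hR := hw.pos
  have hb1 : 0 < 1 / b := by positivity
  set K : ℝ := 2 * R / (1 / b) + 1 with hK
  set L : ℝ := 2 * R / a + 1 with hL
  have hK0 : 0 < K := by positivity
  have hL0 : 0 < L := by positivity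
  refine ⟨K * C ^ 2 * L, by positivity, fun x c => ?_⟩
  set S : ℤ → Finset ℤ := fun n => intWindow (1 / b) (n * a - x) R with hS
  have hmem : ∀ n k : ℤ, k ∈ S n ↔ |x + k / b - n * a| ≤ R := fun n k => by
    rw [hS, mem_intWindow hb1]
    ring_nf
  have hmem' : ∀ n k : ℤ, k ∈ S n ↔ n ∈ intWindow a (x + k / b) R := fun n k => by
    rw [hmem, mem_intWindow ha, abs_sub_comm]
  have hrow : ∀ n, ‖gaborFiber g a b c x n‖ₑ ^ 2 ≤
      ∑' k, (if k ∈ S n then ENNReal.ofReal (K * C ^ 2) * ‖c k‖ₑ ^ 2 else 0) := by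
    intro n
    rw [tsum_eq_sum (s := S n) fun k hk => if_neg hk]
    rw [gaborFiber_eq_sum (S := S n) c fun k hk => by
      rw [hw.eq_zero _ (le_of_not_ge fun h => hk ((hmem n k).2 h)), mul_zero]]
    have h1 : ‖∑ k ∈ S n, c k * g (x + k / b - n * a)‖ ^ 2 ≤
        ∑ k ∈ S n, K * C ^ 2 * ‖c k‖ ^ 2 := by
      calc ‖∑ k ∈ S n, c k * g (x + k / b - n * a)‖ ^ 2
          ≤ (∑ k ∈ S n, C * ‖c k‖) ^ 2 := by
            refine pow_le_pow_left₀ (norm_nonneg _) ((norm_sum_le _ _).trans ?_) 2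
            refine Finset.sum_le_sum fun k _ => ?_
            rw [norm_mul, mul_comm]
            exact mul_le_mul_of_nonneg_right (hC _) (norm_nonneg _)
        _ ≤ (S n).card * ∑ k ∈ S n, (C * ‖c k‖) ^ 2 := sq_sum_le_card_mul_sum_sq
        _ ≤ K * ∑ k ∈ S n, (C * ‖c k‖) ^ 2 :=
            mul_le_mul_of_nonneg_right (card_intWindow_le hb1 hR.le _)
              (Finset.sum_nonneg fun _ _ => sq_nonneg _)
        _ = _ := by
            rw [Finset.mul_sum]
            exact Finset.sum_congr rfl fun k _ => by ring
    rw [← ofReal_norm, ← ENNReal.ofReal_pow (norm_nonneg _)]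
    refine (ENNReal.ofReal_le_ofReal h1).trans ?_
    rw [ENNReal.ofReal_sum_of_nonneg fun _ _ => by positivity]
    refine Finset.sum_le_sum fun k hk => ?_
    rw [if_pos hk, ENNReal.ofReal_mul (by positivity), ENNReal.ofReal_pow (norm_nonneg _),
      ofReal_norm]
  refine (ENNReal.tsum_le_tsum hrow).trans ?_
  rw [ENNReal.tsum_comm, ← ENNReal.tsum_mul_left]
  refine ENNReal.tsum_le_tsum fun k => ?_
  simp only [hmem']
  rw [tsum_eq_sum (s := intWindow a (x + k / b) R) fun n hn => if_neg hn]
  rw [Finset.sum_congr rfl fun n hn => if_pos hn, Finset.sum_const, nsmul_eq_mul, ← mul_assoc,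
    mul_comm (K * C ^ 2) L, ENNReal.ofReal_mul hL0.le]
  refine mul_le_mul_left (mul_le_mul_left ?_ _) _
  rw [← ENNReal.ofReal_natCast]
  exact ENNReal.ofReal_le_ofReal (card_intWindow_le ha hR.le _)

/-- The coarser system is the subfamily with `n` divisible by `M`, so its lower bound persists; the
upper bound holds for any compact window. -/
theorem isHilbertFrame_gaborSystem_of_multiple {g : ℝ → ℂ} {R a b : ℝ} (hw : IsCompactWindow g R)
    (hg : MemLp g 2 volume) (ha : 0 < a) (hb : 0 < b) {M : ℕ} (hM : M ≠ 0)
    (h : IsHilbertFrame (gaborSystem g hg (M * a) b)) :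
    IsHilbertFrame (gaborSystem g hg a b) := by
  obtain ⟨B, hB, hU⟩ := tsum_enorm_sq_gaborFiber_le hw ha hb
  rw [isHilbertFrame_iff_enorm] at h ⊢
  obtain ⟨A, _, hA, _, h⟩ := h
  refine ⟨A, 1 / b * B, hA, by positivity, fun f => ⟨(h f).1.trans ?_, ?_⟩⟩
  · have hinj : Function.Injective fun p : ℤ × ℤ => (p.1, (M : ℤ) * p.2) := by
      rintro ⟨m, n⟩ ⟨m', n'⟩ hp
      simpa [hM] using hp
    have he : ∀ p : ℤ × ℤ, gaborSystem g hg (M * a) b p =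
        gaborSystem g hg a b (p.1, (M : ℤ) * p.2) := fun p => by
      simp only [gaborSystem]
      congr 1
      funext x
      simp only [gaborAtom]
      congr 2
      push_cast
      ring
    simp only [he]
    exact ENNReal.tsum_comp_le_tsum_of_injective hinj
      fun q => ‖⟪f, gaborSystem g hg a b q⟫_ℂ‖ₑ ^ 2
  · have hf : Measurable f := (Lp.stronglyMeasurable f).measurable
    rw [tsum_enorm_sq_inner_gaborSystem hw hg hb f 0, enorm_sq_Lp_two_eq_translates hb f 0,
      ENNReal.ofReal_mul (by positivity), mul_assoc]
    refine mul_le_mul_right ?_ _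
    rw [← lintegral_const_mul _ (by fun_prop)]
    refine lintegral_mono fun x => (hU x _).trans_eq ?_
    congr 1
    refine tsum_congr fun k => ?_
    rw [← ofReal_norm, RCLike.norm_conj, ofReal_norm]

/-! ### Obstructions to the frame property. -/

/-- The test function equals `conj (c k)` on a short interval of length `ε` to the right of `x +
k/b`. Its fibers are `c` near `x` and zero elsewhere on the period; continuity of the window then
gives the bound at `x` itself, not merely almost everywhere. -/
theorem gaborFiber_lower_bound_of_isHilbertFrame {g : ℝ → ℂ} {R a b : ℝ}
    (hw : IsCompactWindow g R) (hg : MemLp g 2 volume) (ha : 0 < a) (hb : 0 < b)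
    (hfr : IsHilbertFrame (gaborSystem g hg a b)) :
    ∃ A : ℝ, 0 < A ∧ ∀ (x : ℝ) (c : ℤ → ℂ) (S T : Finset ℤ), (∀ k ∉ S, c k = 0) →
      (∀ n ∉ T, gaborFiber g a b c x n = 0) →
      A * ∑ k ∈ S, ‖c k‖ ^ 2 ≤ ∑ n ∈ T, ‖gaborFiber g a b c x n‖ ^ 2 := by
  rw [isHilbertFrame_iff_enorm] at hfr
  obtain ⟨A, _, hA, _, hfr⟩ := hfr
  refine ⟨A * b, by positivity, fun x c S T hS hT => ?_⟩
  have hb1 : 0 < 1 / b := by positivity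
  have hsq : ∀ z : ℂ, ‖z‖ₑ ^ 2 = ENNReal.ofReal (‖z‖ ^ 2) :=
    fun z => by rw [ENNReal.ofReal_pow (norm_nonneg _), ofReal_norm]
  set M : ℝ := ∑ k ∈ S, ‖c k‖ ^ 2 with hM
  have hM0 : 0 ≤ M := Finset.sum_nonneg fun _ _ => by positivity
  set T₀ : Finset ℤ := S.biUnion fun k => intWindow a (x + k / b) (R + 1 / b) with hT₀
  have hsum : ∀ y n, gaborFiber g a b c y n = ∑ k ∈ S, c k * g (y + k / b - n * a) :=
    fun y n => gaborFiber_eq_sum c fun k hk => by rw [hS k hk, zero_mul]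
  have hzero : ∀ y ∈ Set.Icc x (x + 1 / b), ∀ n ∉ T₀, gaborFiber g a b c y n = 0 := by
    intro y hy n hn
    rw [hsum]
    refine Finset.sum_eq_zero fun k hk => ?_
    rw [hw.eq_zero, mul_zero]
    refine le_of_not_gt fun hlt => hn (Finset.mem_biUnion.2 ⟨k, hk, ?_⟩)
    rw [mem_intWindow ha, abs_le]
    rw [abs_lt] at hlt
    constructor <;> linarith [hy.1, hy.2]
  set φ : ℝ → ℝ := fun y => ∑ n ∈ T₀, ‖∑ k ∈ S, c k * g (y + k / b - n * a)‖ ^ 2 with hφ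
  have hφc : Continuous φ := by
    have := hw.continuous
    fun_prop
  have hφ0 : ∀ y, 0 ≤ φ y := fun y => Finset.sum_nonneg fun _ _ => by positivity
  have hφeq : ∀ y ∈ Set.Icc x (x + 1 / b),
      ∑' n : ℤ, ‖gaborFiber g a b c y n‖ₑ ^ 2 = ENNReal.ofReal (φ y) := by
    intro y hy
    rw [tsum_eq_sum (s := T₀) fun n hn => by rw [hzero y hy n hn]; simp,
      ENNReal.ofReal_sum_of_nonneg fun _ _ => by positivity]
    exact Finset.sum_congr rfl fun n _ => by rw [hsum, hsq]
  have hφx : φ x = ∑ n ∈ T, ‖gaborFiber g a b c x n‖ ^ 2 := by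
    have h1 : ∑' n : ℤ, ‖gaborFiber g a b c x n‖ ^ 2 = φ x := by
      rw [tsum_eq_sum (s := T₀) fun n hn => by
        rw [hzero x ⟨le_rfl, by linarith⟩ n hn]; simp]
      exact Finset.sum_congr rfl fun n _ => by rw [hsum]
    rw [← h1, tsum_eq_sum (s := T) fun n hn => by rw [hT n hn]; simp]
  rw [← hφx]
  -- The slack `q > φ x` leaves room for `φ ≤ q` on a whole interval `(x, x + ε]`; the factor `ε`
  -- cancels at the end.
  refine le_of_forall_gt_imp_ge_of_dense fun q hq => ?_
  have hq0 : 0 < q := (hφ0 x).trans_lt hq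
  obtain ⟨δ, hδ, hδq⟩ := Metric.eventually_nhds_iff.1 (hφc.continuousAt.eventually_lt_const hq)
  set ε : ℝ := min (δ / 2) (1 / b) with hε
  have hε0 : 0 < ε := lt_min (by positivity) hb1
  have hεb : ε ≤ 1 / b := min_le_right _ _
  have hφq : ∀ y ∈ Set.Ioc x (x + ε), φ y ≤ q := fun y hy => by
    refine (hδq ?_).le
    rw [Real.dist_eq, abs_of_pos (by linarith [hy.1])]
    linarith [hy.2, min_le_left (δ / 2) (1 / b)]
  set f₀ : ℝ → ℂ := fun y => ∑ j ∈ S, Set.indicator (Set.Ioc (x + j / b) (x + j / b + ε))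
    (fun _ => starRingEnd ℂ (c j)) y with hf₀
  have hf₀mem : MemLp f₀ 2 volume :=
    memLp_finsetSum _ fun j _ => memLp_indicator_const 2 measurableSet_Ioc _ (Or.inr (by simp))
  have hf₀val : ∀ y ∈ Set.Ioc x (x + 1 / b), ∀ k : ℤ,
      f₀ (y + k / b) = if y ≤ x + ε then starRingEnd ℂ (c k) else 0 := by
    intro y hy k
    have hne : ∀ j : ℤ, j ≠ k → y + k / b ∉ Set.Ioc (x + j / b) (x + j / b + ε) := by
      rintro j hj ⟨h1, h2⟩
      have h3 : (k : ℝ) - j < 1 := by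
        have : ((k : ℝ) - j) / b < 1 / b := by rw [sub_div]; linarith [hy.1]
        exact (div_lt_div_iff_of_pos_right hb).1 this
      have h4 : (j : ℝ) - k < 1 := by
        have : ((j : ℝ) - k) / b < 1 / b := by rw [sub_div]; linarith [hy.2]
        exact (div_lt_div_iff_of_pos_right hb).1 this
      have h3' : k - j < 1 := by exact_mod_cast h3
      have h4' : j - k < 1 := by exact_mod_cast h4
      omega
    have hself : y + k / b ∈ Set.Ioc (x + k / b) (x + k / b + ε) ↔ y ≤ x + ε := by
      rw [Set.mem_Ioc]
      constructor
      · rintro ⟨-, h⟩; linarith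
      · intro h; constructor <;> linarith [hy.1]
    rw [hf₀]
    simp only
    rw [Finset.sum_eq_single k (fun j _ hj => Set.indicator_of_notMem (hne j hj) _)
      (fun hk => by simp [hS k hk])]
    simp only [Set.indicator_apply, hself]
  set f : Lp ℂ 2 (volume : Measure ℝ) := hf₀mem.toLp f₀ with hf
  have hfae : ∀ᵐ y ∂(volume.restrict (Set.Ioc x (x + 1 / b))), ∀ k : ℤ,
      f (y + k / b) = if y ≤ x + ε then starRingEnd ℂ (c k) else 0 := by
    have h1 : ∀ᵐ y, ∀ k : ℤ, f (y + k / b) = f₀ (y + k / b) := ae_all_iff.2 fun k =>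
      (measurePreserving_add_right volume ((k : ℝ) / b)).quasiMeasurePreserving.ae
        hf₀mem.coeFn_toLp
    filter_upwards [ae_restrict_of_ae h1, ae_restrict_mem measurableSet_Ioc] with y hy hy' k
    rw [hy k, hf₀val y hy' k]
  have hvol : (volume.restrict (Set.Ioc x (x + 1 / b))) (Set.Iic (x + ε)) = ENNReal.ofReal ε := by
    rw [Measure.restrict_apply measurableSet_Iic, Set.inter_comm, Set.Ioc_inter_Iic,
      Real.volume_Ioc, min_eq_right (by linarith), add_sub_cancel_left]
  have hnorm : ‖f‖ₑ ^ 2 = ENNReal.ofReal M * ENNReal.ofReal ε := by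
    rw [enorm_sq_Lp_two_eq_translates hb f x, ← hvol,
      ← lintegral_indicator_const measurableSet_Iic]
    refine lintegral_congr_ae ?_
    filter_upwards [hfae] with y hy
    simp only [hy, Set.indicator_apply, Set.mem_Iic]
    split_ifs
    · rw [tsum_eq_sum (s := S) fun k hk => by simp [hS k hk],
        hM, ENNReal.ofReal_sum_of_nonneg fun _ _ => by positivity]
      exact Finset.sum_congr rfl fun k _ => by rw [hsq, RCLike.norm_conj]
    · simp
  have hupper : ∑' p : ℤ × ℤ, ‖⟪f, gaborSystem g hg a b p⟫_ℂ‖ₑ ^ 2 ≤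
      ENNReal.ofReal (1 / b) * (ENNReal.ofReal q * ENNReal.ofReal ε) := by
    rw [tsum_enorm_sq_inner_gaborSystem hw hg hb f x]
    refine mul_le_mul_right ?_ _
    rw [← hvol, ← lintegral_indicator_const measurableSet_Iic]
    refine lintegral_mono_ae ?_
    filter_upwards [hfae, ae_restrict_mem measurableSet_Ioc] with y hy hy'
    simp only [hy, Set.indicator_apply, Set.mem_Iic]
    split_ifs with h
    · simp only [RingHomCompTriple.comp_apply, RingHom.id_apply]
      rw [hφeq y (Set.Ioc_subset_Icc_self hy')]
      exact ENNReal.ofReal_le_ofReal (hφq y ⟨hy'.1, h⟩)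
    · simp [gaborFiber]
  have hfin := (hfr f).1.trans hupper
  rw [hnorm, ← ENNReal.ofReal_mul hM0, ← ENNReal.ofReal_mul hA.le, ← ENNReal.ofReal_mul hq0.le,
    ← ENNReal.ofReal_mul hb1.le, ENNReal.ofReal_le_ofReal_iff (by positivity)] at hfin
  have h5 : A * M ≤ 1 / b * q := by
    refine le_of_mul_le_mul_right ?_ hε0
    linarith
  calc A * b * M = b * (A * M) := by ring
    _ ≤ b * (1 / b * q) := mul_le_mul_of_nonneg_left h5 hb.le
    _ = q := by field_simp

theorem not_isHilbertFrame_of_support_le {g : ℝ → ℂ} {R a b : ℝ}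
    (hw : IsCompactWindow g R) (hg : MemLp g 2 volume) (hb : 0 < b) (haR : 2 * R ≤ a) :
    ¬ IsHilbertFrame (gaborSystem g hg a b) := by
  intro hfr
  have hR := hw.pos
  have ha : 0 < a := by linarith
  obtain ⟨A, hA, h⟩ := gaborFiber_lower_bound_of_isHilbertFrame hw hg ha hb hfr
  -- At `x = R` every `R - n a` lies outside `(-R, R)`, so column `0` vanishes.
  have h1 := h R (Pi.single 0 1) {0} ∅ (fun k hk => by
    simp only [Finset.mem_singleton] at hk
    simp [hk]) (fun n _ => ?_)
  · simp at h1
    linarith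
  · rw [gaborFiber_eq_sum (S := {0}) _ fun k hk => by
      simp only [Finset.mem_singleton] at hk
      simp [hk]]
    rw [Finset.sum_singleton, hw.eq_zero, mul_zero]
    rcases le_or_gt n 0 with hn | hn
    · have : (n : ℝ) ≤ 0 := by exact_mod_cast hn
      refine le_abs.2 (Or.inl ?_)
      simp only [Int.cast_zero, zero_div, add_zero]
      nlinarith
    · have : (1 : ℝ) ≤ n := by exact_mod_cast hn
      refine le_abs.2 (Or.inr ?_)
      simp only [Int.cast_zero, zero_div, add_zero]
      nlinarith

/-- Truncating to `K` consecutive entries gives squared norm `K`, while the image survives only in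
rows near the two cuts: at most `2 L` rows, each of size at most `D`, independently of `K`. -/
theorem not_isHilbertFrame_of_unimodular_kernel {g : ℝ → ℂ} {R a b : ℝ}
    (hw : IsCompactWindow g R) (hg : MemLp g 2 volume) (ha : 0 < a) (hb : 0 < b)
    (x : ℝ) (c : ℤ → ℂ) (hc : ∀ k, ‖c k‖ = 1) (hker : ∀ n, gaborFiber g a b c x n = 0) :
    ¬ IsHilbertFrame (gaborSystem g hg a b) := by
  intro hfr
  have hR := hw.pos
  have hb1 : 0 < 1 / b := by positivity
  obtain ⟨C, hC0, hC⟩ := hw.exists_bound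
  obtain ⟨A, hA, h⟩ := gaborFiber_lower_bound_of_isHilbertFrame hw hg ha hb hfr
  set D : ℝ := (2 * R / (1 / b) + 1) * C with hD
  set L : ℝ := 2 * R / a + 1 with hL
  have hL0 : 0 < L := by positivity
  obtain ⟨K, hK⟩ := exists_nat_gt (2 * L * D ^ 2 / A)
  rw [div_lt_iff₀ hA] at hK
  set S : Finset ℤ := Finset.Ico 0 (K : ℤ) with hS
  set c' : ℤ → ℂ := fun k => if k ∈ S then c k else 0 with hc'
  set T : Finset ℤ := intWindow a x R ∪ intWindow a (x + K / b) R with hT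
  have hc'1 : ∀ k, ‖c' k‖ ≤ 1 := fun k => by
    simp only [hc']
    split_ifs <;> simp [hc]
  have hvanish : ∀ n ∉ T, gaborFiber g a b c' x n = 0 := by
    intro n hn
    by_cases hin : ∃ k ∈ S, g (x + k / b - n * a) ≠ 0
    · obtain ⟨k, hkS, hk⟩ := hin
      rw [← hker n]
      refine tsum_congr fun l => ?_
      by_cases hl : l ∈ S
      · simp only [hc', if_pos hl]
      · have hgl : g (x + l / b - n * a) = 0 := by
          by_contra hgl
          apply hn
          have h1 := lt_of_not_ge (mt (hw.eq_zero _) hk)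
          have h2 := lt_of_not_ge (mt (hw.eq_zero _) hgl)
          rw [abs_lt] at h1 h2
          rw [hS, Finset.mem_Ico] at hkS hl
          have hk0 : 0 ≤ (k : ℝ) / b := div_nonneg (by exact_mod_cast hkS.1) hb.le
          have hkK : (k : ℝ) / b ≤ K / b :=
            (div_le_div_iff_of_pos_right hb).2 (by exact_mod_cast hkS.2.le)
          rw [hT, Finset.mem_union, mem_intWindow ha, mem_intWindow ha]
          rcases lt_or_ge l 0 with hl0 | hl0
          · left
            have : (l : ℝ) / b ≤ 0 := div_nonpos_of_nonpos_of_nonneg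
              (by exact_mod_cast hl0.le) hb.le
            rw [abs_le]
            constructor <;> linarith
          · right
            have hlK : (K : ℤ) ≤ l := by
              by_contra hh
              exact hl ⟨hl0, not_le.1 hh⟩
            have : (K : ℝ) / b ≤ l / b :=
              (div_le_div_iff_of_pos_right hb).2 (by exact_mod_cast hlK)
            rw [abs_le]
            constructor <;> linarith
        rw [hgl, mul_zero, mul_zero]
    · push Not at hin
      rw [gaborFiber_eq_sum (S := ∅), Finset.sum_empty]
      intro l _
      by_cases hl : l ∈ S
      · rw [hin l hl, mul_zero]
      · simp only [hc', if_neg hl, zero_mul]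
  have hbound : ∀ n, ‖gaborFiber g a b c' x n‖ ^ 2 ≤ D ^ 2 := by
    intro n
    refine pow_le_pow_left₀ (norm_nonneg _) ?_ 2
    rw [gaborFiber_eq_sum (S := intWindow (1 / b) (n * a - x) R) c' fun k hk => by
      rw [hw.eq_zero _ (le_of_not_ge fun h => hk ?_), mul_zero]
      rwa [mem_intWindow hb1, show (k : ℝ) * (1 / b) - (n * a - x) = x + k / b - n * a by ring]]
    refine (norm_sum_le _ _).trans ((Finset.sum_le_card_nsmul _ _ C fun k _ => ?_).trans ?_)
    · rw [norm_mul]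
      exact (mul_le_of_le_one_left (norm_nonneg _) (hc'1 k)).trans (hC _)
    · rw [nsmul_eq_mul]
      exact mul_le_mul_of_nonneg_right (card_intWindow_le hb1 hR.le _) hC0.le
  have h1 := h x c' S T (fun k hk => if_neg hk) hvanish
  have h2 : ∑ k ∈ S, ‖c' k‖ ^ 2 = K := by
    rw [Finset.sum_congr rfl fun k hk => by
      show ‖c' k‖ ^ 2 = 1
      simp only [hc', if_pos hk, hc, one_pow]]
    simp [hS]
  have h3 : ∑ n ∈ T, ‖gaborFiber g a b c' x n‖ ^ 2 ≤ 2 * L * D ^ 2 := by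
    refine (Finset.sum_le_card_nsmul _ _ _ fun n _ => hbound n).trans ?_
    rw [nsmul_eq_mul]
    refine mul_le_mul_of_nonneg_right ?_ (sq_nonneg _)
    calc (T.card : ℝ) ≤ (intWindow a x R).card + (intWindow a (x + K / b) R).card := by
          exact_mod_cast Finset.card_union_le _ _
      _ ≤ L + L := add_le_add (card_intWindow_le ha hR.le _) (card_intWindow_le ha hR.le _)
      _ = 2 * L := by ring
  rw [h2] at h1
  linarith

/-- Dimension count: `K` consecutive columns meet at most `K/(ab) + 2R/a + 1` rows, fewer than `K`
once `K` is large, so some nonzero finitely supported vector is annihilated. -/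
theorem not_isHilbertFrame_of_one_lt_mul {g : ℝ → ℂ} {R a b : ℝ}
    (hw : IsCompactWindow g R) (hg : MemLp g 2 volume) (ha : 0 < a) (hb : 0 < b)
    (hab : 1 < a * b) : ¬ IsHilbertFrame (gaborSystem g hg a b) := by
  intro hfr
  have hR := hw.pos
  obtain ⟨A, hA, h⟩ := gaborFiber_lower_bound_of_isHilbertFrame hw hg ha hb hfr
  have hρ : 0 < 1 - 1 / (a * b) := by
    rw [sub_pos, div_lt_one (by positivity)]
    exact hab
  obtain ⟨K, hK⟩ := exists_nat_gt ((2 * R / a + 1) / (1 - 1 / (a * b)))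
  rw [div_lt_iff₀ hρ] at hK
  set r : ℝ := R + K / b / 2 with hr
  set S : Finset ℤ := Finset.Ico 0 (K : ℤ) with hS
  set T : Finset ℤ := intWindow a (K / b / 2) r with hT
  have hcard : T.card < S.card := by
    have h1 : (T.card : ℝ) ≤ 2 * r / a + 1 := card_intWindow_le ha (by positivity) _
    have h2 : 2 * r / a + 1 = 2 * R / a + 1 + K * (1 / (a * b)) := by
      rw [hr]
      field_simp
      ring
    have h3 : (T.card : ℝ) < K := by linarith
    rw [hS, Int.card_Ico]
    simpa using h3
  let Mx : Matrix T S ℂ := fun n k => g (0 + (k : ℤ) / b - (n : ℤ) * a)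
  have hker : LinearMap.ker Mx.mulVecLin ≠ ⊥ := LinearMap.ker_ne_bot_of_finrank_lt (by
    simpa using hcard)
  obtain ⟨v, hv, hv0⟩ := Submodule.exists_mem_ne_zero_of_ne_bot hker
  set c : ℤ → ℂ := fun k => if hk : k ∈ S then v ⟨k, hk⟩ else 0 with hc
  have hcS : ∀ k ∉ S, c k = 0 := fun k hk => dif_neg hk
  have hfib : ∀ n, gaborFiber g a b c 0 n = 0 := by
    intro n
    rw [gaborFiber_eq_sum (S := S) c fun k hk => by rw [hcS k hk, zero_mul]]
    by_cases hn : n ∈ T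
    · have h1 := congrFun (LinearMap.mem_ker.1 hv) ⟨n, hn⟩
      simp only [Matrix.mulVecLin_apply, Matrix.mulVec, dotProduct, Pi.zero_apply] at h1
      rw [← h1, ← Finset.sum_coe_sort S]
      refine Finset.sum_congr rfl fun k _ => ?_
      simp only [hc, Finset.coe_mem, dif_pos, Mx]
      exact mul_comm _ _
    · refine Finset.sum_eq_zero fun k hk => ?_
      rw [hw.eq_zero, mul_zero]
      refine le_of_not_gt fun hlt => hn ?_
      rw [hS, Finset.mem_Ico] at hk
      have hk0 : 0 ≤ (k : ℝ) / b := div_nonneg (by exact_mod_cast hk.1) hb.le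
      have hkK : (k : ℝ) / b ≤ K / b :=
        (div_le_div_iff_of_pos_right hb).2 (by exact_mod_cast hk.2.le)
      rw [hT, mem_intWindow ha, abs_le]
      rw [abs_lt] at hlt
      constructor <;> linarith
  have h1 := h 0 c S ∅ hcS fun n _ => hfib n
  rw [Finset.sum_empty] at h1
  have h2 : 0 < ∑ k ∈ S, ‖c k‖ ^ 2 := by
    obtain ⟨k, hk⟩ := Function.ne_iff.1 hv0
    refine Finset.sum_pos' (fun _ _ => by positivity) ⟨k, k.2, ?_⟩
    have : c k = v k := by simp only [hc, Finset.coe_mem, dif_pos]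
    rw [this]
    have := norm_pos_iff.2 hk
    positivity
  have := mul_pos hA h2
  linarith

/-- At `x = a/2` the reflection `k ↦ 2n - 1 - k` negates the argument of the even window and flips
the sign `(-1)^k`, so each fiber sum equals its own negative. -/
theorem not_isHilbertFrame_of_mul_eq_one {g : ℝ → ℂ} {R a b : ℝ}
    (hw : IsCompactWindow g R) (hg : MemLp g 2 volume) (heven : ∀ x, g (-x) = g x)
    (ha : 0 < a) (hb : 0 < b) (hab : a * b = 1) : ¬ IsHilbertFrame (gaborSystem g hg a b) := by
  have hab' : ∀ k : ℤ, (k : ℝ) / b = k * a := fun k => by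
    rw [div_eq_iff hb.ne', mul_assoc, hab, mul_one]
  refine not_isHilbertFrame_of_unimodular_kernel hw hg ha hb (a / 2) (fun k => (-1) ^ k)
    (fun k => by simp) fun n => ?_
  have h1 : gaborFiber g a b (fun k => (-1) ^ k) (a / 2) n =
      -gaborFiber g a b (fun k => (-1) ^ k) (a / 2) n := by
    conv_lhs => rw [gaborFiber, ← (Equiv.subLeft (2 * n - 1)).tsum_eq]
    rw [gaborFiber, ← tsum_neg]
    refine tsum_congr fun k => ?_
    simp only [Equiv.subLeft_apply, hab']
    have e1 : ((-1 : ℂ)) ^ (2 * n - 1 - k) = -(-1) ^ k := by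
      rw [zpow_sub₀ (by norm_num), zpow_sub₀ (by norm_num), zpow_mul]
      rcases Int.even_or_odd k with h | h
      · simp [h.neg_one_zpow]
      · simp [h.neg_one_zpow]
    have e2 : a / 2 + ((2 * n - 1 - k : ℤ) : ℝ) * a - n * a = -(a / 2 + k * a - n * a) := by
      push_cast
      ring
    rw [e1, e2, heven, neg_mul]
  exact self_eq_neg.1 h1

/-- With `k = q m + r`, the factor `ζ^k` depends only on `r`, and summing over `q` gives `1` by the
partition of unity. What remains is the vanishing sum of all `m`-th roots of unity. -/
theorem not_isHilbertFrame_of_partition_of_unity {g : ℝ → ℂ} {R a : ℝ}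
    (hw : IsCompactWindow g R) (hg : MemLp g 2 volume)
    (hpart : ∀ x, HasSum (fun k : ℤ => g (x + k)) 1)
    (ha : 0 < a) {m : ℕ} (hm : 2 ≤ m) : ¬ IsHilbertFrame (gaborSystem g hg a m) := by
  have hm0 : (m : ℝ) ≠ 0 := by positivity
  have hmpos : (0 : ℝ) < m := by positivity
  have : NeZero m := ⟨by omega⟩
  set ζ : ℂ := Complex.exp (2 * Real.pi * Complex.I / m) with hζ
  have hprim : IsPrimitiveRoot ζ m := Complex.isPrimitiveRoot_exp m (by omega)
  have hζ0 : ζ ≠ 0 := Complex.exp_ne_zero _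
  refine not_isHilbertFrame_of_unimodular_kernel hw hg ha hmpos 0 (fun k => ζ ^ k)
    (fun k => by rw [norm_zpow, hprim.norm'_eq_one (by omega), one_zpow]) fun n => ?_
  have hsummable : Summable fun k : ℤ => ζ ^ k * g (0 + k / m - n * a) :=
    summable_of_ne_finset_zero (s := intWindow (1 / m) (n * a - 0) (R + 1 / m)) fun k hk => by
      rw [hw.eq_zero_of_notMem hmpos ⟨le_rfl, by positivity⟩ hk, mul_zero]
  set e : Fin m × ℤ ≃ ℤ := (Equiv.prodComm _ _).trans (Int.divModEquiv m).symm with he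
  have heval : ∀ r q, e (r, q) = q * m + (r : ℕ) := fun r q => by
    simp [he, Int.divModEquiv]
  have hsummable' := e.summable_iff.2 hsummable
  simp only [Function.comp_def] at hsummable'
  rw [gaborFiber, ← e.tsum_eq, hsummable'.tsum_prod, tsum_fintype]
  have hinner : ∀ r : Fin m,
      ∑' q : ℤ, ζ ^ (e (r, q)) * g (0 + (e (r, q) : ℤ) / m - n * a) = ζ ^ (r : ℕ) := by
    intro r
    have h1 := ((hpart ((r : ℕ) / m - n * a)).mul_left (ζ ^ (r : ℕ))).tsum_eq
    rw [mul_one] at h1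
    rw [← h1]
    refine tsum_congr fun q => ?_
    rw [heval, zpow_add₀ hζ0, mul_comm q, zpow_mul, zpow_natCast, hprim.pow_eq_one, one_zpow,
      one_mul, zpow_natCast]
    congr 2
    push_cast
    field_simp
    ring
  rw [Finset.sum_congr rfl fun r _ => hinner r, Fin.sum_univ_eq_sum_range (fun r => ζ ^ r)]
  exact hprim.geom_sum_eq_zero (by omega)

/-! ### Diagonal dominance in the range `R ≤ a < 2 R`. -/

/-- Multiply the triangle inequality by `2‖z₀‖`, split each product by AM–GM (weighted by `η` for
the `z` term), and absorb `(u + v + η)‖z₀‖²` by row dominance. -/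
theorem diagonal_mul_sq_le {d u v η : ℝ} (hη : 0 < η) (hu : 0 ≤ u) (hv : 0 ≤ v)
    (hd : u + v + η ≤ d) (z₀ z₁ z₂ : ℂ) :
    d * ‖z₀‖ ^ 2 ≤ ‖(z₀ * d + z₁ * u + z₂ * v : ℂ)‖ ^ 2 / η + u * ‖z₁‖ ^ 2 + v * ‖z₂‖ ^ 2 := by
  set z : ℂ := z₀ * d + z₁ * u + z₂ * v with hz
  have hd0 : 0 ≤ d := by linarith
  have h1 : d * ‖z₀‖ ≤ ‖z‖ + u * ‖z₁‖ + v * ‖z₂‖ := by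
    have e : (d : ℂ) * z₀ = z - (u : ℂ) * z₁ - (v : ℂ) * z₂ := by rw [hz]; ring
    calc d * ‖z₀‖ = ‖(d : ℂ) * z₀‖ := by
          rw [norm_mul, Complex.norm_real, Real.norm_of_nonneg hd0]
      _ ≤ ‖z‖ + ‖(u : ℂ) * z₁‖ + ‖(v : ℂ) * z₂‖ := by
          rw [e]
          exact (norm_sub_le _ _).trans (add_le_add_left (norm_sub_le _ _) _)
      _ = _ := by
          rw [norm_mul, norm_mul, Complex.norm_real, Complex.norm_real, Real.norm_of_nonneg hu,
            Real.norm_of_nonneg hv]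
  have h2 := mul_le_mul_of_nonneg_right h1 (norm_nonneg z₀)
  have h3 : 2 * (‖z‖ * ‖z₀‖) ≤ ‖z‖ ^ 2 / η + η * ‖z₀‖ ^ 2 := by
    have : ‖z‖ ^ 2 / η + η * ‖z₀‖ ^ 2 - 2 * (‖z‖ * ‖z₀‖) = (‖z‖ - η * ‖z₀‖) ^ 2 / η := by
      field_simp
      ring
    have : 0 ≤ (‖z‖ - η * ‖z₀‖) ^ 2 / η := by positivity
    linarith
  have h4 := mul_nonneg hu (sq_nonneg (‖z₀‖ - ‖z₁‖))
  have h5 := mul_nonneg hv (sq_nonneg (‖z₀‖ - ‖z₂‖))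
  have h6 := mul_le_mul_of_nonneg_right hd (sq_nonneg ‖z₀‖)
  nlinarith

/-- Summing the pointwise bounds and shifting indices turns the off-diagonal terms into column sums,
which column dominance controls. They must be finite to be cancelled, hence `D` and `hfin`. -/
theorem tsum_lower_bound_of_tridiagonal {q w d u v : ℤ → ℝ} {η D : ℝ} (hη : 0 < η)
    (hq : ∀ k, 0 ≤ q k) (hw : ∀ k, 0 ≤ w k) (hu : ∀ k, 0 ≤ u k) (hv : ∀ k, 0 ≤ v k)
    (hD : ∀ k, d k ≤ D) (hcol : ∀ k, u (k - 1) + v (k + 1) + η ≤ d k)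
    (hpt : ∀ k, d k * q k ≤ w k / η + u k * q (k + 1) + v k * q (k - 1))
    (hfin : ∑' k, ENNReal.ofReal (q k) ≠ ⊤) :
    ENNReal.ofReal (η ^ 2) * ∑' k, ENNReal.ofReal (q k) ≤ ∑' k, ENNReal.ofReal (w k) := by
  set U := ∑' k, ENNReal.ofReal (u (k - 1) * q k) with hU
  set V := ∑' k, ENNReal.ofReal (v (k + 1) * q k) with hV
  have hfinite : ∀ r : ℤ → ℝ, (∀ k, r k ≤ D) → ∑' k, ENNReal.ofReal (r k * q k) ≠ ⊤ := by
    intro r hr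
    refine ne_top_of_le_ne_top (ENNReal.mul_ne_top ENNReal.ofReal_ne_top hfin
      (a := ENNReal.ofReal D)) ?_
    rw [← ENNReal.tsum_mul_left]
    refine ENNReal.tsum_le_tsum fun k => ?_
    rw [← ENNReal.ofReal_mul' (hq k)]
    exact ENNReal.ofReal_le_ofReal (mul_le_mul_of_nonneg_right (hr k) (hq k))
  have hU' : U ≠ ⊤ := hfinite _ fun k => by linarith [hcol k, hv (k + 1), hD k]
  have hV' : V ≠ ⊤ := hfinite _ fun k => by linarith [hcol k, hu (k - 1), hD k]
  have hUs : ∑' k, ENNReal.ofReal (u k * q (k + 1)) = U := by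
    rw [hU, ← (Equiv.addRight (1 : ℤ)).tsum_eq fun k => ENNReal.ofReal (u (k - 1) * q k)]
    simp only [Equiv.coe_addRight, add_sub_cancel_right]
  have hVs : ∑' k, ENNReal.ofReal (v k * q (k - 1)) = V := by
    rw [hV, ← (Equiv.subRight (1 : ℤ)).tsum_eq fun k => ENNReal.ofReal (v (k + 1) * q k)]
    simp only [Equiv.subRight_apply, sub_add_cancel]
  have h1 : ENNReal.ofReal η * ∑' k, ENNReal.ofReal (q k) + (U + V) ≤
      ∑' k, ENNReal.ofReal (d k * q k) := by
    rw [hU, hV, ← ENNReal.tsum_mul_left, ← ENNReal.tsum_add, ← ENNReal.tsum_add]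
    refine ENNReal.tsum_le_tsum fun k => ?_
    have a1 := mul_nonneg (hu (k - 1)) (hq k)
    have a2 := mul_nonneg (hv (k + 1)) (hq k)
    have a3 := mul_nonneg hη.le (hq k)
    rw [← ENNReal.ofReal_mul hη.le, ← ENNReal.ofReal_add a1 a2,
      ← ENNReal.ofReal_add a3 (by linarith)]
    refine ENNReal.ofReal_le_ofReal ?_
    have := mul_le_mul_of_nonneg_right (hcol k) (hq k)
    linarith
  have h2 : ∑' k, ENNReal.ofReal (d k * q k) ≤
      ENNReal.ofReal (1 / η) * ∑' k, ENNReal.ofReal (w k) + (U + V) := by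
    rw [← hUs, ← hVs, ← ENNReal.tsum_mul_left, ← ENNReal.tsum_add, ← ENNReal.tsum_add]
    refine ENNReal.tsum_le_tsum fun k => ?_
    have a1 := mul_nonneg (hu k) (hq (k + 1))
    have a2 := mul_nonneg (hv k) (hq (k - 1))
    have a3 : 0 ≤ 1 / η * w k := mul_nonneg (by positivity) (hw k)
    rw [← ENNReal.ofReal_mul (by positivity), ← ENNReal.ofReal_add a1 a2,
      ← ENNReal.ofReal_add a3 (by linarith)]
    refine ENNReal.ofReal_le_ofReal ((hpt k).trans_eq ?_)
    ring
  have h3 := (ENNReal.add_le_add_iff_right (ENNReal.add_ne_top.2 ⟨hU', hV'⟩)).1 (h1.trans h2)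
  calc ENNReal.ofReal (η ^ 2) * ∑' k, ENNReal.ofReal (q k)
      = ENNReal.ofReal η * (ENNReal.ofReal η * ∑' k, ENNReal.ofReal (q k)) := by
        rw [sq, ENNReal.ofReal_mul hη.le, mul_assoc]
    _ ≤ ENNReal.ofReal η * (ENNReal.ofReal (1 / η) * ∑' k, ENNReal.ofReal (w k)) :=
        mul_le_mul_right h3 _
    _ = _ := by
        rw [← mul_assoc, ← ENNReal.ofReal_mul hη.le, mul_one_div_cancel hη.ne',
          ENNReal.ofReal_one, one_mul]

/-- A continuous even window supported in `[-R, R]` and strictly decreasing on `[0, R]` generates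
a Gabor frame whenever `R ≤ a < 2 R` and `a b < 1`. -/
theorem isHilbertFrame_of_strictAntiOn {γ : ℝ → ℝ} {R a b : ℝ}
    (hw : IsCompactWindow (fun x => (γ x : ℂ)) R) (hg : MemLp (fun x => (γ x : ℂ)) 2 volume)
    (heven : ∀ x, γ (-x) = γ x) (hanti : StrictAntiOn γ (Set.Icc 0 R))
    (hRa : R ≤ a) (haR : a < 2 * R) (hb : 0 < b) (hab : a * b < 1) :
    IsHilbertFrame (gaborSystem (fun x => (γ x : ℂ)) hg a b) := by
  have hR := hw.pos
  have ha : 0 < a := hR.trans_le hRa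
  have hβ : a < 1 / b := by rwa [lt_div_iff₀ hb]
  set β : ℝ := 1 / b with hβdef
  have hzero : ∀ s, R ≤ |s| → γ s = 0 := fun s hs => by
    simpa using hw.eq_zero s hs
  have habs : ∀ s, γ |s| = γ s := fun s => by
    rcases abs_choice s with h | h <;> rw [h]
    exact heven s
  have hnonneg : ∀ s, 0 ≤ γ s := fun s => by
    rcases le_or_gt R |s| with h | h
    · exact (hzero s h).ge
    · rw [← habs, ← hzero R (le_abs_self R)]
      exact (hanti ⟨abs_nonneg s, h.le⟩ ⟨hR.le, le_rfl⟩ h).le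
  have hmono : ∀ s t, |s| ≤ |t| → γ t ≤ γ s := fun s t hst => by
    rcases le_or_gt R |t| with h | h
    · rw [hzero t h]
      exact hnonneg s
    · rw [← habs s, ← habs t]
      exact hanti.antitoneOn ⟨abs_nonneg s, hst.trans h.le⟩ ⟨abs_nonneg t, h.le⟩ hst
  -- `γ (a/2)` bounds the diagonal entries below and `γ (β - a/2)` the neighbours above; the gap is
  -- positive because `a/2 < R` and `a < β`.
  set η : ℝ := γ (a / 2) - γ (β - a / 2) with hηdef
  have hη : 0 < η := by
    rw [hηdef, sub_pos]
    have h1 : γ (β - a / 2) ≤ γ (min (β - a / 2) R) := by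
      refine hmono _ _ ?_
      rw [abs_of_pos (lt_min (by linarith) hR), abs_of_pos (by linarith)]
      exact min_le_left _ _
    exact h1.trans_lt (hanti ⟨by linarith, by linarith⟩
      ⟨le_min (by linarith) hR.le, min_le_right _ _⟩ (lt_min (by linarith) (by linarith)))
  refine isHilbertFrame_of_fiber_bounds hw hg hb (tsum_enorm_sq_gaborFiber_le hw ha hb)
    ⟨η ^ 2, by positivity, fun x c hc => ?_⟩
  set y : ℤ → ℝ := fun k => x + k / b with hy
  -- Column `k` is paired with the row whose translate is centred nearest to `y k`. Since `β > a`,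
  -- distinct columns get distinct rows.
  set ν : ℤ → ℤ := fun k => round (y k / a) with hν
  set τ : ℤ → ℝ := fun k => y k - ν k * a with hτ
  have hτabs : ∀ k, |τ k| ≤ a / 2 := fun k => by
    have h1 := abs_sub_round (y k / a)
    have h2 : τ k = (y k / a - round (y k / a)) * a := by
      simp only [hτ, hν]
      field_simp
    rw [h2, abs_mul, abs_of_pos ha]
    nlinarith
  have hτ1 : ∀ k, -(a / 2) ≤ τ k := fun k => (abs_le.1 (hτabs k)).1
  have hτ2 : ∀ k, τ k ≤ a / 2 := fun k => (abs_le.1 (hτabs k)).2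
  have hysucc : ∀ k, y (k + 1) = y k + β := fun k => by
    simp only [hy, hβdef]
    push_cast
    ring
  have hνsucc : ∀ k, ν k + 1 ≤ ν (k + 1) := fun k => by
    have h1 : (ν k : ℝ) < ν (k + 1) := by
      have h3 := hτ1 k
      have h4 := hτ2 (k + 1)
      simp only [hτ, hysucc] at h3 h4
      nlinarith
    exact_mod_cast h1
  have hνmono : StrictMono ν := strictMono_int_of_lt_succ fun k => by linarith [hνsucc k]
  have hshift : ∀ k l : ℤ, x + l / b - ν k * a = τ k + (l - k) * β := fun k l => by
    simp only [hτ, hy, hβdef]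
    ring
  have hfib : ∀ k, gaborFiber (fun x => (γ x : ℂ)) a b c x (ν k) =
      c k * (γ (τ k) : ℂ) + c (k + 1) * (γ (τ k + β) : ℂ) + c (k - 1) * (γ (τ k - β) : ℂ) := by
    intro k
    rw [gaborFiber_eq_sum (S := {k, k + 1, k - 1}) c]
    · rw [Finset.sum_insert (by simp; omega), Finset.sum_insert (by simp; omega),
        Finset.sum_singleton]
      simp only [hshift]
      push_cast
      ring_nf
    · intro l hl
      simp only [Finset.mem_insert, Finset.mem_singleton, not_or] at hl
      rw [hw.eq_zero, mul_zero]
      rw [hshift]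
      have h1 := hτ1 k
      have h2 := hτ2 k
      rcases lt_or_ge k l with h | h
      · have : (2 : ℝ) ≤ (l : ℝ) - k := by
          have : k + 2 ≤ l := by omega
          have : ((k + 2 : ℤ) : ℝ) ≤ l := by exact_mod_cast this
          push_cast at this
          linarith
        refine le_abs.2 (Or.inl ?_)
        nlinarith
      · have : (l : ℝ) - k ≤ -2 := by
          have : l ≤ k - 2 := by omega
          have : (l : ℝ) ≤ ((k - 2 : ℤ) : ℝ) := by exact_mod_cast this
          push_cast at this
          linarith
        refine le_abs.2 (Or.inr ?_)
        nlinarith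
  have hdiag : ∀ k, γ (a / 2) ≤ γ (τ k) := fun k => by
    refine hmono _ _ ?_
    rw [abs_of_pos (by linarith : 0 < a / 2)]
    exact hτabs k
  have hplus : ∀ k, γ (τ k + β) ≤ γ (β - a / 2) := fun k => by
    refine hmono _ _ ?_
    rw [abs_of_pos (by linarith : 0 < β - a / 2)]
    exact le_abs.2 (Or.inl (by linarith [hτ1 k]))
  have hminus : ∀ k, γ (τ k - β) ≤ γ (β - a / 2) := fun k => by
    refine hmono _ _ ?_
    rw [abs_of_pos (by linarith : 0 < β - a / 2)]
    exact le_abs.2 (Or.inr (by linarith [hτ2 k]))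
  -- The sign of `τ k` pushes one neighbour to distance at least `β > a ≥ R`, so only one
  -- off-diagonal entry can survive.
  have hrow : ∀ k, γ (τ k + β) + γ (τ k - β) + η ≤ γ (τ k) := by
    intro k
    rcases le_total 0 (τ k) with h | h
    · have := hzero (τ k + β) (le_abs.2 (Or.inl (by linarith)))
      linarith [hminus k, hdiag k]
    · have := hzero (τ k - β) (le_abs.2 (Or.inr (by linarith)))
      linarith [hplus k, hdiag k]
  -- The right side is `(ν (k + 1) - ν k) a`; this spacing gives the columns the same one-neighbour
  -- property as the rows.
  have hτsucc : ∀ k, a ≤ τ k + β - τ (k + 1) := by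
    intro k
    have h1 : ((ν k + 1 : ℤ) : ℝ) ≤ ν (k + 1) := by exact_mod_cast hνsucc k
    push_cast at h1
    simp only [hτ, hysucc]
    nlinarith
  have hcol : ∀ k, γ (τ (k - 1) + β) + γ (τ (k + 1) - β) + η ≤ γ (τ k) := by
    intro k
    have h1 := hτsucc (k - 1)
    have h2 := hτsucc k
    rw [sub_add_cancel] at h1
    rcases le_total 0 (τ k) with h | h
    · have := hzero (τ (k - 1) + β) (le_abs.2 (Or.inl (by linarith)))
      linarith [hminus (k + 1), hdiag k]
    · have := hzero (τ (k + 1) - β) (le_abs.2 (Or.inr (by linarith)))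
      linarith [hplus (k - 1), hdiag k]
  have hsq : ∀ z : ℂ, ‖z‖ₑ ^ 2 = ENNReal.ofReal (‖z‖ ^ 2) :=
    fun z => by rw [ENNReal.ofReal_pow (norm_nonneg _), ofReal_norm]
  simp only [hsq] at hc ⊢
  refine (tsum_lower_bound_of_tridiagonal (D := γ 0)
    (w := fun k => ‖gaborFiber (fun x => (γ x : ℂ)) a b c x (ν k)‖ ^ 2) (d := fun k => γ (τ k))
    (u := fun k => γ (τ k + β)) (v := fun k => γ (τ k - β)) hη (fun _ => by positivity)
    (fun _ => by positivity) (fun _ => hnonneg _) (fun _ => hnonneg _)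
    (fun k => hmono _ _ (by simp)) hcol (fun k => ?_) hc).trans ?_
  · rw [hfib]
    exact diagonal_mul_sq_le hη (hnonneg _) (hnonneg _) (hrow k) _ _ _
  · exact ENNReal.tsum_comp_le_tsum_of_injective hνmono.injective
      fun n => ENNReal.ofReal (‖gaborFiber (fun x => (γ x : ℂ)) a b c x n‖ ^ 2)

/-! ### Doubling the translation step, and the conclusion. -/

/-- `M` is the first power of two reaching either threshold. One doubling earlier both quantities
were below `R` and `1/2`, so neither overshoots `2 R` or `1`. -/
theorem exists_mul_mem_of_lt {R a b : ℝ} (ha : 0 < a) (haR : a < 2 * R) (hab : a * b < 1) :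
    ∃ M : ℕ, M ≠ 0 ∧ M * a < 2 * R ∧ M * a * b < 1 ∧ (R ≤ M * a ∨ 1 / 2 ≤ M * a * b) := by
  have hex : ∃ j : ℕ, R ≤ (2 ^ j : ℕ) * a ∨ 1 / 2 ≤ (2 ^ j : ℕ) * a * b := by
    obtain ⟨j, hj⟩ := pow_unbounded_of_one_lt (R / a) (by norm_num : (1 : ℝ) < 2)
    rw [div_lt_iff₀ ha] at hj
    exact ⟨j, Or.inl (by push_cast; exact hj.le)⟩
  classical
  obtain ⟨j, hj, hmin⟩ : ∃ j : ℕ, (R ≤ (2 ^ j : ℕ) * a ∨ 1 / 2 ≤ (2 ^ j : ℕ) * a * b) ∧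
      ∀ i < j, ¬ (R ≤ (2 ^ i : ℕ) * a ∨ 1 / 2 ≤ (2 ^ i : ℕ) * a * b) :=
    ⟨Nat.find hex, Nat.find_spec hex, fun i hi => Nat.find_min hex hi⟩
  refine ⟨2 ^ j, by positivity, ?_, ?_, hj⟩ <;> rcases j with _ | i
  · simpa using haR
  · have := hmin i (Nat.lt_succ_self i)
    push Not at this
    rw [pow_succ]
    push_cast at this ⊢
    linarith [this.1]
  · simpa using hab
  · have := hmin i (Nat.lt_succ_self i)
    push Not at this
    rw [pow_succ]
    push_cast at this ⊢
    linarith [this.2]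

theorem isCompactWindow_bSplineWindow {N : ℕ} (hN : 2 ≤ N) :
    IsCompactWindow (bSplineWindow N) ((N : ℝ) / 2) := by
  obtain ⟨k, rfl⟩ : ∃ k, N = k + 2 := ⟨N - 2, by omega⟩
  obtain ⟨hc, -, hs, -⟩ := bSpline_shape k
  exact ⟨Complex.continuous_ofReal.comp hc, by positivity, fun x hx => by
    rw [bSplineWindow, hs x hx, Complex.ofReal_zero]⟩

theorem mem_grochenigSet_of_mem_bSplineFrameSet {N : ℕ} (hN : 2 ≤ N) {a b : ℝ}
    (h : (a, b) ∈ bSplineFrameSet N) : (a, b) ∈ grochenigSet N := by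
  obtain ⟨ha, hb, hfr⟩ := h
  simp only at ha hb hfr
  have hw := isCompactWindow_bSplineWindow hN
  have hg := memLp_bSplineWindow N
  obtain ⟨k, rfl⟩ : ∃ k, N = k + 2 := ⟨N - 2, by omega⟩
  obtain ⟨-, he, -, -⟩ := bSpline_shape k
  refine ⟨ha, hb, ?_, ?_, ?_⟩
  · by_contra hlt
    refine not_isHilbertFrame_of_support_le hw hg hb ?_ hfr
    simp only at hlt
    linarith
  · rcases lt_trichotomy (a * b) 1 with hab | hab | hab
    · exact hab
    · refine absurd hfr (not_isHilbertFrame_of_mul_eq_one hw hg (fun x => ?_) ha hb hab)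
      rw [bSplineWindow, bSplineWindow, he]
    · exact absurd hfr (not_isHilbertFrame_of_one_lt_mul hw hg ha hb hab)
  · rintro m hm hbm
    simp only at hbm
    subst hbm
    refine not_isHilbertFrame_of_partition_of_unity hw hg (fun x => ?_) ha hm hfr
    exact Complex.hasSum_ofReal.2 (hasSum_bSpline_int_translates k x)

theorem mem_bSplineFrameSet_of_mem_grochenigSet {N : ℕ} (hN : 2 ≤ N) {a b : ℝ}
    (hyp : ∀ a : ℝ, 0 < a → a < (N : ℝ) / 2 → 1 / 2 ≤ a * b → a * b < 1 →
        (∀ k : ℕ, 2 ≤ k → b ≠ k) →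
        IsHilbertFrame (gaborSystem (bSplineWindow N) (memLp_bSplineWindow N) a b))
    (h : (a, b) ∈ grochenigSet N) : (a, b) ∈ bSplineFrameSet N := by
  obtain ⟨ha, hb, haN, hab, hbk⟩ := h
  simp only at ha hb haN hab hbk
  refine ⟨ha, hb, ?_⟩
  have hw := isCompactWindow_bSplineWindow hN
  obtain ⟨M, hM, h1, h2, h3⟩ := exists_mul_mem_of_lt (R := (N : ℝ) / 2) ha (by linarith) hab
  refine isHilbertFrame_gaborSystem_of_multiple hw (memLp_bSplineWindow N) ha hb hM ?_
  have hMa : 0 < M * a := by positivity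
  rcases le_or_gt ((N : ℝ) / 2) (M * a) with hR | hR
  · obtain ⟨k, rfl⟩ : ∃ k, N = k + 2 := ⟨N - 2, by omega⟩
    obtain ⟨-, he, -, hanti⟩ := bSpline_shape k
    exact isHilbertFrame_of_strictAntiOn hw (memLp_bSplineWindow _) he hanti hR h1 hb h2
  · exact hyp _ hMa hR (h3.resolve_left hR.not_ge) h2 hbk

theorem proposition3p2 (N : ℕ) (hN : 2 ≤ N) :
    ((∀ a b : ℝ, 0 < a → 0 < b → a < (N : ℝ) / 2 → 1 / 2 ≤ a * b → a * b < 1 →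
        (∀ k : ℕ, 2 ≤ k → b ≠ k) →
        IsHilbertFrame (gaborSystem (bSplineWindow N) (memLp_bSplineWindow N) a b)) →
      bSplineFrameSet N = grochenigSet N) ∧
    (∀ b : ℝ, 0 < b →
      (∀ a : ℝ, 0 < a → a < (N : ℝ) / 2 → 1 / 2 ≤ a * b → a * b < 1 →
        (∀ k : ℕ, 2 ≤ k → b ≠ k) →
        IsHilbertFrame (gaborSystem (bSplineWindow N) (memLp_bSplineWindow N) a b)) →
      ∀ a : ℝ, (a, b) ∈ bSplineFrameSet N ↔ (a, b) ∈ grochenigSet N) := by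
  refine ⟨fun hyp => Set.ext fun ⟨a, b⟩ =>
    ⟨mem_grochenigSet_of_mem_bSplineFrameSet hN, fun h => ?_⟩, fun b _ hyp a =>
    ⟨mem_grochenigSet_of_mem_bSplineFrameSet hN, mem_bSplineFrameSet_of_mem_grochenigSet hN hyp⟩⟩
  exact mem_bSplineFrameSet_of_mem_grochenigSet hN (fun a' ha' => hyp a' b ha' h.2.1) h
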